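/- **Setting.** Consider the isothermal $p$-system $\partial_t\tau-\partial_x v=0$, $\partial_t v+\partial_x(1/\tau)=0$, with eigenvalues $\lambda_{1,2}=\mp 1/\tau$. Put $w=-\ln\tau$, and let $W(s)=s$ for $s\le 0$, $W(s)=2\sinh(s/2)$ for $s\ge 0$. The $i$-wave curve through $(w,v)$ is $T_i(\sigma)(w,v)=(w+(-1)^{i-1}\sigma,\;v-W(\sigma))$; for $\sigma>0$ the wave is an $i$-shock, for $\sigma<0$ an $i$-rarefaction, of strength $|\sigma|$. The solution of the Riemann problem $(u_l,u_r)$ is the pair $(\sigma_1,\sigma_2)$ with $(w_r,v_r)=T_2(\sigma_2)T_1(\sigma_1)(w_l,v_l)$. **Constants.** Let $C_0,C_1,\epsilon>0$ with $C_0\epsilon\le\frac12$ and $C_1\le(1-C_0\epsilon)^2$. (In the application these are the constants of the $a$-contraction with shifts, $C_1$ and $\epsilon$ being taken sufficiently small. There the ratio $a_2/a_1$ of the weights on the right and on the left of a shock of strength $\sigma$ is admissible if it is $\le C_1$ for a $1$-shock, $\ge 1/C_1$ for a $2$-shock, when $\sigma\ge\epsilon/2$; and if it lies in $[1-2C_0\sigma,1-\frac{C_0}2\sigma]$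 for a $1$-shock, in $[1+\frac{C_0}2\sigma,1+2C_0\sigma]$ for a $2$-shock, when $\sigma<\epsilon$.) **Scheme.** Let $u^0=(\tau^0,v^0)\in L^\infty(\mathbb R)$ have finite total variation, with $\tau^0\ge\beta>0$, and let $0<\delta<\epsilon/2$. Let $\psi^0_\delta=(\tau^0_\delta,v^0_\delta)$ be piecewise constant with finitely many jumps, $\mathrm{TV}(\psi^0_\delta)\le 2\,\mathrm{TV}(u^0)$, $\|\psi_\delta^0\|_{L^\infty}\le\|u^0\|_{L^\infty}$, $\tau^0_\delta\ge\beta$. At $t=0$ each jump of $\psi^0_\delta$, and at each time $t^*>0$ at which two waves meet the jump so created, is replaced by the solution $(\sigma_1,\sigma_2)$ of its Riemann problem. A wave with $\sigma_i<0$ is split into $p=\lceil|\sigma_i|/\delta\rceil$ rarefaction fronts of strength $|\sigma_i|/p$, each moving, between interactions, with constant speed $\lambda_i(u_r)$, where $u_r$ is the state on its right, up to a (small) perturbation of the speed. A wave with $\sigma_i>0$ is one shock front. It moves along a Lipschitz curve $h$ with $-\hat\lambda\le\dot h<0$ a.e. if $i=1$, and $0<\dot h\le\hat\lambda$ a.e.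 if $i=2$, for some $\hat\lambda>0$. It is labelled *big* or *small*: at $t=0$, big iff its strength is $\ge\epsilon$; at $t^*>0$ by the rules below. At any time $t>0$ there is at most one interaction, and it involves only two waves. Waves of different families pass through each other, keeping their strengths and labels. For two waves of family $1$ (in any order), with strengths $\sigma,\sigma'$, the types of interaction and the labels of the outgoing shocks are as follows. * (1) big + big, (2) big + small: the $1$-shock is big. * (3) big + rarefaction: the $1$-shock is big if $\sigma_1\ge\epsilon/2$ (3A), small if $\sigma_1<\epsilon/2$ (3B). * (4) small + small: the $1$-shock is small if $\sigma_1<\epsilon$ (4A), big if $\sigma_1\ge\epsilon$ (4B). * (5) small + rarefaction: (5A) if $\sigma_1>0$, the $1$-shock is small; (5B) if $\sigma_1\le0$. * In types 3 and 5 the outgoing $2$-shock is small. Types 6–10 are types 1–5 with the two families exchanged. **Weight.** Let $L(t)$ be the number of interactions of type 1, 3B or 9B in $(0,t)$. Let $Q(t)$ be the product, with multiplicity, over the interactions in $(0,t)$ of the following factors, where $\sigma_1,\sigma_2$ solve the Riemann problem of the interaction: * type 2: $1-C_0\sigma$, with $\sigma$ the strength of the incoming small shock; * type 3A: $\frac1{1+C_0\sigma_2}$;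 * type 4A: $\min\left(\frac{(1-C_0\sigma)(1-C_0\sigma')}{1-C_0\sigma_1},1\right)$, with $\sigma,\sigma'$ the strengths of the incoming shocks; * type 5A: $\frac{1-C_0\sigma}{(1-C_0\sigma_1)(1+C_0\sigma_2)}$, and type 5B: $\frac{1-C_0\sigma}{1+C_0\sigma_2}$, with $\sigma$ the strength of the incoming small shock; * all other types: $1$. For each shock $x_i(t)$ of strength $\sigma_i$ present at time $t$ let $\xi_i(t,x)=1$ for $x<x_i(t)$; for $x>x_i(t)$ let $\xi_i(t,x)$ be $1-C_0\sigma_i$, $1+C_0\sigma_i$, $C_1$, $\frac1{C_1}$ if the shock is, respectively, a small $1$-shock, a small $2$-shock, a big $1$-shock, a big $2$-shock. Put $$a(t,x)=C_1^{L(t)}\,Q(t)\prod_{i:\text{shock}}\xi_i(t,x),$$ which is defined wherever $x$ is not on a shock curve at time $t$. **Proposition.** There exist $\overline c,\overline C>0$, depending only on $C_0,C_1,\epsilon,\beta$ and on upper bounds for $\|u^0\|_{L^\infty}$ and $\mathrm{TV}(u^0)$ (in particular not on $\delta$), such that for every such pattern, on any time interval $[0,T)$ on which it has been constructed by finitely many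 interactions: 1. $\overline c\le a(t,x)\le\overline C$ for all $t \in [0,T)$ and all $x$ not on a shock curve at time $t$. 2. At every interaction time $t>0$ and for almost every $x$, the limits $a(t\pm,x)$ exist and $a(t+,x)\le a(t-,x)$. 3. At every time $t>0$ without interaction and for every shock $x_i(t)$ of strength $\sigma_i$, the limits $a(t,x_i(t)\pm)$ exist, $a(t,x_i(t)-)>0$, and $$\frac{a(t,x_i(t)+)}{a(t,x_i(t)-)}=\begin{cases}C_1&\text{big }1\text{-shock},\\ 1/C_1&\text{big }2\text{-shock},\\ 1-C_0\sigma_i&\text{small }1\text{-shock},\\ 1+C_0\sigma_i&\text{small }2\text{-shock}.\end{cases}$$ -/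

import Mathlib

open Set Filter Topology MeasureTheory
open scoped NNReal ENNReal

namespace FrontTracking

/-! ### States, wave curves, eigenvalues -/

/-- Physical states `u = (τ, v)` with the Euclidean norm: `u 0 = τ` is the specific volume,
`u 1 = v` the velocity. -/
abbrev State : Type := EuclideanSpace ℝ (Fin 2)

/-- The same state in the coordinates `(w, v)` with `w = -ln τ`. -/
noncomputable def wv (u : State) : ℝ × ℝ := (-Real.log (u 0), u 1)

/-- `W(s) = s` for `s ≤ 0` and `W(s) = 2 sinh (s / 2)` for `s ≥ 0`. -/
noncomputable def W (s : ℝ) : ℝ := if s ≤ 0 then s else 2 * Real.sinh (s / 2)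

/-- The two characteristic families. -/
inductive Family
  | one
  | two

/-- The `i`-wave curve `σ ↦ T_i(σ)(w, v) = (w + (-1)^(i-1) σ, v - W(σ))`; `σ > 0` is an `i`-shock,
`σ < 0` an `i`-rarefaction. -/
noncomputable def waveCurve : Family → ℝ → ℝ × ℝ → ℝ × ℝ
  | .one, σ, z => (z.1 + σ, z.2 - W σ)
  | .two, σ, z => (z.1 - σ, z.2 - W σ)

/-- The eigenvalues `λ_{1,2} = ∓ 1 / τ`, where `1 / τ = exp w`. -/
noncomputable def eigenvalue : Family → ℝ × ℝ → ℝ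
  | .one, z => -Real.exp z.1
  | .two, z => Real.exp z.1

/-- `(σ₁, σ₂)` solves the Riemann problem with left state `zl` and right state `zr`
(states in the `(w, v)` coordinates). -/
def SolvesRiemann (zl zr : ℝ × ℝ) (σ₁ σ₂ : ℝ) : Prop :=
  zr = waveCurve .two σ₂ (waveCurve .one σ₁ zl)

/-! ### Fronts and their labels -/

/-- Shocks are labelled big or small; all other fronts are (pieces of) rarefactions. -/
inductive Label
  | big
  | small
  | rarefaction

/-- Whether a front with this label is a shock. -/
def Label.isShock : Label → Bool
  | .big => true
  | .small => true
  | .rarefaction => false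

/-- A front, with its strength measured by the size of the jump in `w`. -/
structure Front where
  fam : Family
  label : Label
  strength : ℝ

/-- The parameter of the front on its wave curve: positive for shocks, negative for rarefactions. -/
def Front.signed (f : Front) : ℝ :=
  match f.label with
  | .rarefaction => -f.strength
  | _ => f.strength

/-- A front together with its path `t ↦ x(t)`. -/
structure Wave extends Front where
  path : ℝ → ℝ

/-- The state to the right of a list of fronts (ordered from left to right) whose left state
is `z`. -/
noncomputable def stateAfter (z : ℝ × ℝ) (l : List Wave) : ℝ × ℝ :=
  l.foldl (fun y f => waveCurve f.fam f.toFront.signed y) z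

/-- The fronts by which the solver replaces the wave `T_i(σ)`: a shock is one front, with label `lab`;
a rarefaction is split into `p = ⌈|σ| / δ⌉` fronts of strength `|σ| / p`; if `σ = 0` there is none. -/
noncomputable def fan (δ : ℝ) (i : Family) (lab : Label) (σ : ℝ) : List Front :=
  if 0 < σ then [⟨i, lab, σ⟩]
  else if σ < 0 then
    List.replicate ⌈|σ| / δ⌉₊ ⟨i, .rarefaction, |σ| / (⌈|σ| / δ⌉₊ : ℝ)⟩
  else []

/-- At the initial time a shock is big exactly if its strength is at least `ε`. -/
noncomputable def initialLabel (ε σ : ℝ) : Label := if ε ≤ σ then .big else .small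

/-- The approximate solution of a Riemann problem at the initial time. -/
noncomputable def initialFan (ε δ σ₁ σ₂ : ℝ) : List Front :=
  fan δ .one (initialLabel ε σ₁) σ₁ ++ fan δ .two (initialLabel ε σ₂) σ₂

/-! ### Interactions at positive times -/

/-- The kinds of two-wave interactions. `passing`: waves of different families.
`rarefactions`: two rarefactions of one family; this does not happen for the exact wave speeds. -/
inductive InteractionType
  | t1 | t2 | t3A | t3B | t4A | t4B | t5A | t5B
  | t6 | t7 | t8A | t8B | t9A | t9B | t10A | t10B
  | passing
  | rarefactions

/-- The type of the interaction of `p` (on the left) with `q` (on the right), where `σ₁, σ₂` solve the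
resulting Riemann problem. Types 1 to 5 concern two waves of the first family, types 6 to 10 two waves
of the second one:
1, 6: big + big; 2, 7: big + small; 3, 8: big + rarefaction (A: the outgoing shock of
that family has strength at least `ε / 2`, B: less than `ε / 2`); 4, 9: small + small (A: the outgoing
shock has strength less than `ε`, B: at least `ε`); 5, 10: small + rarefaction (A: the outgoing wave
of that family is a shock, B: it is a rarefaction). The order of the two waves does not matter. -/
noncomputable def interactionType (ε : ℝ) (p q : Front) (σ₁ σ₂ : ℝ) : InteractionType :=
  match p.fam, q.fam with
  | .one, .one =>
    match p.label, q.label with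
    | .big, .big => .t1
    | .big, .small | .small, .big => .t2
    | .big, .rarefaction | .rarefaction, .big => if ε / 2 ≤ σ₁ then .t3A else .t3B
    | .small, .small => if σ₁ < ε then .t4A else .t4B
    | .small, .rarefaction | .rarefaction, .small => if 0 < σ₁ then .t5A else .t5B
    | .rarefaction, .rarefaction => .rarefactions
  | .two, .two =>
    match p.label, q.label with
    | .big, .big => .t6
    | .big, .small | .small, .big => .t7
    | .big, .rarefaction | .rarefaction, .big => if ε / 2 ≤ σ₂ then .t8A else .t8B
    | .small, .small => if σ₂ < ε then .t9A else .t9B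
    | .small, .rarefaction | .rarefaction, .small => if 0 < σ₂ then .t10A else .t10B
    | .rarefaction, .rarefaction => .rarefactions
  | _, _ => .passing

/-- The label of an outgoing `1`-shock (waves of the same family interacting). -/
def outLabelOne : InteractionType → Label
  | .t1 | .t2 | .t3A | .t4B => .big
  | _ => .small

/-- The label of an outgoing `2`-shock (waves of the same family interacting). -/
def outLabelTwo : InteractionType → Label
  | .t6 | .t7 | .t8A | .t9B => .big
  | _ => .small

/-- The fronts that leave an interaction, from left to right. Waves of different families pass through
each other; otherwise the Riemann problem is solved, and outgoing shocks are labelled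
according to the type of the interaction. -/
noncomputable def outgoing (ε δ : ℝ) (p q : Front) (σ₁ σ₂ : ℝ) : List Front :=
  match interactionType ε p q σ₁ σ₂ with
  | .passing =>
    match p.fam with
    | .one => [p, q]
    | .two => [q, p]
  | ty => fan δ .one (outLabelOne ty) σ₁ ++ fan δ .two (outLabelTwo ty) σ₂

/-! ### Front tracking patterns -/

/-- The total variation seminorm of an almost everywhere defined function on the line: the least
variation of its representatives. -/
noncomputable def essVariation (u : ℝ → State) : ℝ≥0∞ :=
  ⨅ (g : ℝ → State) (_ : g =ᵐ[volume] u), eVariationOn g univ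

/-- A piecewise constant initial datum: jump points `x 0 < ... < x (m - 1)`, and values
`u 0, ..., u m` from left to right. -/
structure StepDatum where
  m : ℕ
  x : Fin m → ℝ
  u : Fin (m + 1) → State
  x_strictMono : StrictMono x

/-- The total variation of a piecewise constant datum. -/
noncomputable def StepDatum.variation (ψ : StepDatum) : ℝ≥0∞ :=
  ∑ j : Fin ψ.m, ‖ψ.u j.succ - ψ.u j.castSucc‖ₑ

/-- The requirements on the piecewise constant approximation `ψ` of the initial datum `u₀`. -/
structure StepDatum.Approximates (ψ : StepDatum) (u₀ : ℝ → State) (β : ℝ) : Prop where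
  variation_le : ψ.variation ≤ 2 * essVariation u₀
  norm_le : ∀ j, ‖ψ.u j‖ₑ ≤ eLpNorm u₀ ⊤ volume
  le_tau : ∀ j, β ≤ ψ.u j 0

/-- The parameters of the scheme: the constants `C₀, C₁, ε` and the maximal shift speed `lam` of the
shock contraction theory, the rarefaction parameter `δ`, and a bound `ν` on the perturbation of the
rarefaction speeds by which multiple collisions are avoided. -/
structure Params where
  C₀ : ℝ
  C₁ : ℝ
  ε : ℝ
  δ : ℝ
  lam : ℝ≥0
  ν : ℝ

/-- How a front moves during the time interval `[s, t]`, if `z` is the state on its right.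
Shocks follow Lipschitz shifts with speed in `[-lam, 0)` (`1`-shocks) or `(0, lam]` (`2`-shocks);
rarefaction fronts have a constant speed, the eigenvalue at `z` up to the error `ν`. -/
def Wave.Travels (c : Params) (f : Wave) (z : ℝ × ℝ) (s t : ℝ) : Prop :=
  match f.label, f.fam with
  | .rarefaction, i => ∃ speed : ℝ, |speed - eigenvalue i z| ≤ c.ν ∧
      ∀ r ∈ Icc s t, f.path r = f.path s + (r - s) * speed
  | _, .one => LipschitzOnWith c.lam f.path (Icc s t) ∧
      ∀ᵐ r ∂(volume.restrict (Ioo s t)), -(c.lam : ℝ) ≤ deriv f.path r ∧ deriv f.path r < 0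
  | _, .two => LipschitzOnWith c.lam f.path (Icc s t) ∧
      ∀ᵐ r ∂(volume.restrict (Ioo s t)), 0 < deriv f.path r ∧ deriv f.path r ≤ (c.lam : ℝ)

/-- The data of one interaction: the waves `p` and `q` collide, `left` and `right` are the waves on
either side of the collision, `σ₁, σ₂` solve the Riemann problem, and `out` are the outgoing waves. -/
structure Collision where
  left : List Wave
  p : Wave
  q : Wave
  right : List Wave
  σ₁ : ℝ
  σ₂ : ℝ
  out : List Wave

/-- The collision `κ` takes place at time `t`, involves two waves only, is the only one at that time,
and is resolved by the Riemann solver; `z` is the state at `x = -∞`. -/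
structure Collision.OccursAt (κ : Collision) (c : Params) (z : ℝ × ℝ) (t : ℝ) : Prop where
  meet : κ.p.path t = κ.q.path t
  single : (κ.left ++ κ.p :: κ.right).Pairwise (fun f g => f.path t < g.path t)
  riemann : SolvesRiemann (stateAfter z κ.left) (stateAfter z (κ.left ++ [κ.p, κ.q])) κ.σ₁ κ.σ₂
  out_fronts : κ.out.map Wave.toFront = outgoing c.ε c.δ κ.p.toFront κ.q.toFront κ.σ₁ κ.σ₂
  out_start : ∀ f ∈ κ.out, f.path t = κ.p.path t

/-- The type of a collision. -/
noncomputable def Collision.type (κ : Collision) (ε : ℝ) : InteractionType :=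
  interactionType ε κ.p.toFront κ.q.toFront κ.σ₁ κ.σ₂

/-- A pattern of the modified front tracking scheme on `[0, T) × ℝ` with initial datum `ψ`, as produced
by a run of the scheme. There are `n` interactions, number `k` (`k = 0, ..., n - 1`) at the
time `time (k + 1)`; `waves k` are the waves present between `time k` and `time (k + 1)`, from left to
right. The values of `time`, `waves`, `coll` at larger indices are irrelevant. -/
structure Pattern (c : Params) (ψ : StepDatum) where
  T : ℝ
  n : ℕ
  time : ℕ → ℝ
  waves : ℕ → List Wave
  /-- the solutions of the Riemann problems at the initial time, and the fronts that replace them -/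
  σ₁ : Fin ψ.m → ℝ
  σ₂ : Fin ψ.m → ℝ
  start : Fin ψ.m → List Wave
  coll : ℕ → Collision
  time_zero : time 0 = 0
  time_lt : ∀ k ≤ n, time k < time (k + 1)
  time_last : time (n + 1) = T
  start_riemann : ∀ j, SolvesRiemann (wv (ψ.u j.castSucc)) (wv (ψ.u j.succ)) (σ₁ j) (σ₂ j)
  start_fronts : ∀ j, (start j).map Wave.toFront = initialFan c.ε c.δ (σ₁ j) (σ₂ j)
  start_pos : ∀ j, ∀ f ∈ start j, f.path 0 = ψ.x j
  waves_zero : waves 0 = (List.ofFn start).flatten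
  /-- motion of the waves between interactions -/
  travels : ∀ k ≤ n, ∀ (l : List Wave) (f : Wave) (r : List Wave), waves k = l ++ f :: r →
    f.Travels c (stateAfter (wv (ψ.u 0)) (l ++ [f])) (time k) (time (k + 1))
  /-- no interaction takes place strictly between two successive interaction times -/
  ordered : ∀ k ≤ n, ∀ t ∈ Ioo (time k) (time (k + 1)),
    (waves k).Pairwise (fun f g => f.path t < g.path t)
  /-- the interactions -/
  occurs : ∀ k < n, (coll k).OccursAt c (wv (ψ.u 0)) (time (k + 1))
  waves_before : ∀ k < n, waves k = (coll k).left ++ [(coll k).p, (coll k).q] ++ (coll k).right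
  waves_after : ∀ k < n, waves (k + 1) = (coll k).left ++ (coll k).out ++ (coll k).right

/-! ### The weight -/

/-- The increment of `L` at an interaction. -/
def InteractionType.jumpL : InteractionType → ℕ
  | .t1 | .t3B | .t9B => 1
  | _ => 0

/-- The strength of the small shock in an interaction of one small shock with another wave. -/
def smallStrength (p q : Front) : ℝ :=
  match p.label with
  | .small => p.strength
  | _ => q.strength

/-- The number that an interaction adds to `K`, that is, the factor by which it multiplies `Q`. -/
noncomputable def Collision.factor (κ : Collision) (c : Params) : ℝ :=
  match κ.type c.ε with
  | .t2 => 1 - c.C₀ * smallStrength κ.p.toFront κ.q.toFront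
  | .t3A => 1 / (1 + c.C₀ * κ.σ₂)
  | .t4A => min ((1 - c.C₀ * κ.p.strength) * (1 - c.C₀ * κ.q.strength) / (1 - c.C₀ * κ.σ₁)) 1
  | .t5A => (1 - c.C₀ * smallStrength κ.p.toFront κ.q.toFront) /
      ((1 - c.C₀ * κ.σ₁) * (1 + c.C₀ * κ.σ₂))
  | .t5B => (1 - c.C₀ * smallStrength κ.p.toFront κ.q.toFront) / (1 + c.C₀ * κ.σ₂)
  | _ => 1

/-- The value of `ξ` to the right of a shock. -/
noncomputable def Front.ratio (c : Params) (f : Front) : ℝ :=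
  match f.label, f.fam with
  | .small, .one => 1 - c.C₀ * f.strength
  | .small, .two => 1 + c.C₀ * f.strength
  | .big, .one => c.C₁
  | .big, .two => 1 / c.C₁
  | .rarefaction, _ => 1

/-- The function `ξ` of a shock: `1` on its left, the prescribed ratio on its right. -/
noncomputable def Wave.xi (c : Params) (f : Wave) (t x : ℝ) : ℝ :=
  (Iio (f.path t)).indicator (fun _ => (1 : ℝ)) x +
    (Ioi (f.path t)).indicator (fun _ => f.toFront.ratio c) x

namespace Pattern

variable {c : Params} {ψ : StepDatum}

/-- The indices of the interactions that take place before time `t`. -/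
noncomputable def before (P : Pattern c ψ) (t : ℝ) : Finset ℕ :=
  (Finset.range P.n).filter (fun k => P.time (k + 1) < t)

/-- The waves present at time `t` (at an interaction time: those about to interact). -/
noncomputable def wavesAt (P : Pattern c ψ) (t : ℝ) : List Wave := P.waves (P.before t).card

/-- The shocks present at time `t`. -/
noncomputable def shocksAt (P : Pattern c ψ) (t : ℝ) : List Wave :=
  (P.wavesAt t).filter (fun f => f.label.isShock)

/-- `L(t)`, the number of interactions of type 1, 3B, 9B before time `t`. -/
noncomputable def L (P : Pattern c ψ) (t : ℝ) : ℕ :=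
  ∑ k ∈ P.before t, ((P.coll k).type c.ε).jumpL

/-- `Q(t)`, the product of the numbers accumulated before time `t`, with multiplicity. -/
noncomputable def Q (P : Pattern c ψ) (t : ℝ) : ℝ :=
  ∏ k ∈ P.before t, (P.coll k).factor c

/-- The weight `a(t, x) = C₁ ^ L(t) * Q(t) * ∏ ξ_i(t, x)`, the product being over the shocks. -/
noncomputable def weight (P : Pattern c ψ) (t x : ℝ) : ℝ :=
  c.C₁ ^ P.L t * P.Q t * ((P.shocksAt t).map (fun f => f.xi c t x)).prod

end Pattern

end FrontTracking

/-!
The proof rests on functionals of Glimm type, all of them sums over the fronts present.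

In the coordinates `(w, v)` the total strength of all fronts does not increase: when two shocks of one
family merge it is conserved, and when a shock of strength `a` meets a rarefaction of its family and
leaves with parameter `s`, it drops by exactly twice the loss `a - max s 0` of the shock
(`riemann_shock_rarefaction`). As `W` is expanding and has Lipschitz constant `cosh (R / 2)` on
`[0, R]`, this loss also controls the strength of the reflected shock. Initially the total strength is
bounded through the total variation of the datum (`Pattern.sum_strength_fronts_zero_le`), which
gives the bound `R` for all times.

To the total strength one adds suitable multiples of
* the total strength of the shocks, which in a merger of shocks drops by the strength of the
  rarefaction created; it pays for the small mergers;
* minus the sum of `W` over the big shocks, which by superadditivity of `W` pays for the small shocks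
  absorbed by big ones, and for the creation of big shocks;
* the number of big shocks, which pays for their mergers and for their turning small;
* the deficits `max 0 (ε - s)` of the big shocks. A big shock is born with strength at least `ε` and
  turns small only below `ε / 2`; by then it has either a deficit or a loss that add up to
  at least `ε / 2`, so that this term pays for the disappearance of its `W`.

The increases of the last four terms in the interaction of a shock with a rarefaction are at most
proportional to the loss, hence compensated by the total strength. With coefficients as in `Coeffs` the
resulting potential drops, at each interaction, by at least minus the logarithm of the factor that
the interaction contributes to `C₁ ^ L * Q` (`Collision.stepBound`). The potential is bounded by a
multiple of the total strength, so `C₁ ^ L * Q` is bounded from below; it is at most `1`, and the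
product of the ratios at the shocks is bounded both ways by exponentials of the total strength.

Across an interaction, the weight on the left is multiplied by a factor at most `1`, and the weight on
the right by this factor times the quotient of the products of the ratios of the outgoing and of
the incoming shocks; that this is at most `1` is checked type by type. The jumps at the shocks can be
read off from the product formula for the weight, `prod_xi_eq_ratioProd`.
-/

namespace FrontTracking

/-! ### The function `W` and the Riemann problem of two waves of one family -/

lemma W_of_nonpos {s : ℝ} (h : s ≤ 0) : W s = s := if_pos h

lemma W_of_nonneg {s : ℝ} (h : 0 ≤ s) : W s = 2 * Real.sinh (s / 2) := by
  rcases h.eq_or_lt with rfl | h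
  · simp [W]
  · exact if_neg (not_le.mpr h)

/-- `W` is expanding: `W - id` is nondecreasing. -/
lemma sub_le_W_sub {a b : ℝ} (h : a ≤ b) : b - a ≤ W b - W a := by
  have key : ∀ x y : ℝ, 0 ≤ x → x ≤ y → y - x ≤ W y - W x := by
    intro x y hx hxy
    rw [W_of_nonneg hx, W_of_nonneg (hx.trans hxy)]
    have : Real.sinh (x / 2) - x / 2 ≤ Real.sinh (y / 2) - y / 2 :=
      Real.sinh_sub_id_strictMono.monotone (by linarith)
    linarith
  rcases le_total 0 a with ha | ha
  · exact key a b ha h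
  rcases le_total 0 b with hb | hb
  · have h0 := key 0 b le_rfl hb
    rw [W_of_nonpos le_rfl] at h0
    rw [W_of_nonpos ha]
    linarith
  · rw [W_of_nonpos ha, W_of_nonpos hb]

lemma W_strictMono : StrictMono W := fun a b h => by
  have := sub_le_W_sub h.le
  linarith

lemma le_W_of_nonneg {s : ℝ} (h : 0 ≤ s) : s ≤ W s := by
  have := sub_le_W_sub h
  rw [W_of_nonpos le_rfl] at this
  linarith

lemma W_add_le {a b : ℝ} (ha : 0 ≤ a) (hb : 0 ≤ b) : W a + W b ≤ W (a + b) := by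
  rw [W_of_nonneg ha, W_of_nonneg hb, W_of_nonneg (add_nonneg ha hb), add_div, Real.sinh_add]
  have h1 : 0 ≤ Real.sinh (a / 2) := Real.sinh_nonneg_iff.mpr (by linarith)
  have h2 : 0 ≤ Real.sinh (b / 2) := Real.sinh_nonneg_iff.mpr (by linarith)
  nlinarith [Real.one_le_cosh (a / 2), Real.one_le_cosh (b / 2)]

lemma W_sub_le {R a b : ℝ} (ha : 0 ≤ a) (hab : a ≤ b) (hb : b ≤ R) :
    W b - W a ≤ Real.cosh (R / 2) * (b - a) := by
  rw [W_of_nonneg ha, W_of_nonneg (ha.trans hab)]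
  have h : Real.sinh (b / 2) - Real.sinh (a / 2) ≤ Real.cosh (R / 2) * (b / 2 - a / 2) := by
    refine (convex_Icc (a / 2) (b / 2)).image_sub_le_mul_sub_of_deriv_le
      Real.continuous_sinh.continuousOn Real.differentiable_sinh.differentiableOn ?_
      _ (left_mem_Icc.mpr (by linarith)) _ (right_mem_Icc.mpr (by linarith)) (by linarith)
    intro x hx
    rw [interior_Icc] at hx
    rw [Real.deriv_sinh]
    apply Real.cosh_le_cosh.mpr
    rw [abs_of_nonneg (by linarith [hx.1]), abs_of_nonneg (by linarith [hx.1])]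
    linarith [hx.2]
  linarith

/-- Two shocks of one family merge into a stronger shock of that family and a rarefaction of the
other one. -/
lemma riemann_shock_shock {a b s o : ℝ} (ha : 0 < a) (hb : 0 < b) (h₁ : s - o = a + b)
    (h₂ : W s + W o = W a + W b) : o ≤ 0 ∧ W a + W b ≤ W s ∧ a ≤ s ∧ b ≤ s := by
  have ho : o ≤ 0 := by
    by_contra! ho
    have h3 := W_strictMono (show a + b < s by linarith)
    have h4 := W_add_le ha.le hb.le
    have h5 := le_W_of_nonneg ho.le
    linarith
  have hW : W a + W b ≤ W s := by
    rw [W_of_nonpos ho] at h₂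
    linarith
  have h4 := le_W_of_nonneg ha.le
  have h5 := le_W_of_nonneg hb.le
  exact ⟨ho, hW, W_strictMono.le_iff_le.mp (by linarith), W_strictMono.le_iff_le.mp (by linarith)⟩

/-- A shock `a` meets a rarefaction `-η` of its family: the reflected wave `o` is a shock, and
it is controlled by the loss `a - max s 0` of the strength of the shock, which also
governs the decrease of the total strength. -/
lemma riemann_shock_rarefaction {R a η s o : ℝ} (ha : 0 < a) (haR : a ≤ R) (hη : 0 < η)
    (h₁ : s - o = a + -η) (h₂ : W s + W o = W a + W (-η)) :
    0 ≤ o ∧ s ≤ a ∧ o ≤ η ∧ |s| + o = a + η - 2 * (a - max s 0) ∧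
      2 * o ≤ Real.cosh (R / 2) * (a - max s 0) := by
  have hWη : W (-η) = -η := W_of_nonpos (by linarith)
  rw [hWη] at h₂
  have ho : 0 ≤ o := by
    by_contra! ho
    have h3 := W_strictMono (show s < a - η by linarith)
    have h4 := sub_le_W_sub (show a - η ≤ a by linarith)
    have h5 := W_strictMono ho
    rw [W_of_nonpos le_rfl] at h5
    linarith
  have hWo := le_W_of_nonneg ho
  have hsa : s ≤ a := W_strictMono.le_iff_le.mp (by linarith)
  refine ⟨ho, hsa, by linarith, ?_, ?_⟩
  · rcases le_total 0 s with hs | hs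
    · rw [abs_of_nonneg hs, max_eq_left hs]
      linarith
    · rw [abs_of_nonpos hs, max_eq_right hs]
      linarith
  · have hl := W_sub_le (R := R) (le_max_right s 0) (max_le hsa ha.le) haR
    have hm : W (max s 0) - max s 0 = W s - s := by
      rcases le_total 0 s with hs | hs
      · rw [max_eq_left hs]
      · rw [max_eq_right hs, W_of_nonpos le_rfl, W_of_nonpos hs]
        ring
    have hn : max s 0 ≤ a := max_le hsa ha.le
    linarith

/-- Two rarefactions of one family do not create a wave of the other one. -/
lemma riemann_rarefaction_rarefaction {a b s o : ℝ} (ha : a < 0) (hb : b < 0)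
    (h₁ : s - o = a + b) (h₂ : W s + W o = W a + W b) : s = a + b ∧ o = 0 := by
  have hab : W (a + b) = a + b := W_of_nonpos (by linarith)
  rw [W_of_nonpos ha.le, W_of_nonpos hb.le] at h₂
  have ho : o = 0 := by
    rcases lt_trichotomy o 0 with ho | ho | ho
    · have h3 := W_strictMono (show s < a + b by linarith)
      rw [W_of_nonpos ho.le] at h₂
      linarith
    · exact ho
    · have h3 := W_strictMono (show a + b < s by linarith)
      have h4 := le_W_of_nonneg ho.le
      linarith
  exact ⟨by linarith, ho⟩

/-- The waves of a Riemann problem are no stronger than its jump. -/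
lemma riemann_abs_add_abs_le {s₁ s₂ d e : ℝ} (h₁ : s₁ - s₂ = d) (h₂ : W s₁ + W s₂ = e) :
    |s₁| + |s₂| ≤ |d| + |e| := by
  subst h₁ h₂
  have g1 := abs_nonneg (W s₁ + W s₂)
  have g2 := abs_nonneg (s₁ - s₂)
  rcases le_total 0 s₁ with h1 | h1 <;> rcases le_total 0 s₂ with h2 | h2
  · have := le_abs_self (W s₁ + W s₂)
    have := le_W_of_nonneg h1
    have := le_W_of_nonneg h2
    rw [abs_of_nonneg h1, abs_of_nonneg h2]
    linarith
  · have := le_abs_self (s₁ - s₂)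
    rw [abs_of_nonneg h1, abs_of_nonpos h2]
    linarith
  · have := neg_abs_le (s₁ - s₂)
    rw [abs_of_nonpos h1, abs_of_nonneg h2]
    linarith
  · have := neg_abs_le (W s₁ + W s₂)
    rw [W_of_nonpos h1, W_of_nonpos h2] at *
    rw [abs_of_nonpos h1, abs_of_nonpos h2]
    linarith

/-! ### The interaction potential -/

/-- Coefficients of the interaction potential, for strengths bounded by `R`. The fields other than
the five coefficients are the inequalities that make the potential drop enough at each interaction. -/
structure Coeffs (C₀ C₁ ε R : ℝ) where
  total : ℝ
  shock : ℝ
  deficit : ℝ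
  growth : ℝ
  count : ℝ
  shock_ge : 4 * C₀ ≤ shock
  deficit_nonneg : 0 ≤ deficit
  deficit_ge : growth * (Real.cosh (R / 2) * R) ≤ deficit * (ε / 2)
  growth_ge : 2 * C₀ ≤ growth
  growth_mul_ge : count - Real.log C₁ ≤ growth * ε
  count_ge : -Real.log C₁ ≤ count
  total_ge : (shock + growth + C₀) * Real.cosh (R / 2) + deficit + 2 * C₀ ≤ total

/-- The coefficients exist. -/
lemma nonempty_coeffs {C₀ C₁ ε R : ℝ} (hC₀ : 0 < C₀) (hC₁ : 0 < C₁) (hC₁' : C₁ ≤ 1) (hε : 0 < ε)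
    (hR : 0 ≤ R) : Nonempty (Coeffs C₀ C₁ ε R) := by
  have hq : 0 ≤ -Real.log C₁ := by linarith [Real.log_nonpos hC₁.le hC₁']
  have hK := Real.cosh_pos (R / 2)
  set q := -Real.log C₁ with hq'
  refine ⟨⟨_, 4 * C₀, (2 * C₀ + 2 * q / ε) * (Real.cosh (R / 2) * R) * (2 / ε),
    2 * C₀ + 2 * q / ε, q, le_rfl, by positivity, ?_, ?_, ?_, le_rfl, le_rfl⟩⟩
  · apply le_of_eq
    field_simp
  · have : 0 ≤ 2 * q / ε := by positivity
    linarith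
  · have : (2 * C₀ + 2 * q / ε) * ε = 2 * C₀ * ε + 2 * q := by field_simp
    rw [this]
    nlinarith

/-- The contribution of a front with label `lab` and strength `s` to the potential: a multiple of the
strength, larger for shocks; for a big shock moreover its deficit below the threshold `ε`, its
size measured by `W` (with a negative sign), and a constant. -/
noncomputable def Coeffs.potential {C₀ C₁ ε R : ℝ} (k : Coeffs C₀ C₁ ε R) (lab : Label) (s : ℝ) :
    ℝ :=
  match lab with
  | .rarefaction => k.total * s
  | .small => (k.total + k.shock) * s
  | .big => (k.total + k.shock) * s + k.deficit * max 0 (ε - s) - k.growth * W s + k.count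

section Drop

variable {C₀ C₁ ε R a b η s o : ℝ} (k : Coeffs C₀ C₁ ε R)

lemma potential_big_big (hC₀ : 0 < C₀) (ha : 0 < a) (hb : 0 < b) (h₁ : s - o = a + b)
    (h₂ : W s + W o = W a + W b) :
    k.potential .big s + k.total * |o| - Real.log C₁ ≤ k.potential .big a + k.potential .big b := by
  obtain ⟨ho, hW, has, -⟩ := riemann_shock_shock ha hb h₁ h₂
  have h3 : max 0 (ε - s) ≤ max 0 (ε - a) := max_le_max le_rfl (by linarith)
  have h4 := mul_le_mul_of_nonneg_left h3 k.deficit_nonneg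
  have h4' := mul_nonneg k.deficit_nonneg (le_max_left 0 (ε - b))
  have h5 := mul_le_mul_of_nonneg_left hW (show 0 ≤ k.growth by linarith [k.growth_ge])
  have h6 := mul_nonneg_of_nonpos_of_nonpos (show -k.shock ≤ 0 by linarith [k.shock_ge]) ho
  have h7 : s = a + b + o := by linarith
  have h8 := k.count_ge
  simp only [Coeffs.potential, abs_of_nonpos ho]
  rw [mul_add] at h5
  have h9 : (k.total + k.shock) * s + k.total * -o
      = (k.total + k.shock) * a + (k.total + k.shock) * b + k.shock * o := by rw [h7]; ring
  linarith

lemma potential_big_small (hC₀ : 0 < C₀) (ha : 0 < a) (hb : 0 < b) (h₁ : s - o = a + b)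
    (h₂ : W s + W o = W a + W b) :
    k.potential .big s + k.total * |o| + 2 * C₀ * b ≤
      k.potential .big a + k.potential .small b := by
  obtain ⟨ho, hW, has, -⟩ := riemann_shock_shock ha hb h₁ h₂
  have h3 : max 0 (ε - s) ≤ max 0 (ε - a) := max_le_max le_rfl (by linarith)
  have h4 := mul_le_mul_of_nonneg_left h3 k.deficit_nonneg
  have h5 := mul_le_mul_of_nonneg_left hW (show 0 ≤ k.growth by linarith [k.growth_ge])
  have h6 := mul_nonneg_of_nonpos_of_nonpos (show -k.shock ≤ 0 by linarith [k.shock_ge]) ho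
  have h7 : s = a + b + o := by linarith
  have h8 : 2 * C₀ * b ≤ k.growth * W b :=
    mul_le_mul k.growth_ge (le_W_of_nonneg hb.le) hb.le (by linarith [k.growth_ge])
  simp only [Coeffs.potential, abs_of_nonpos ho]
  rw [mul_add] at h5
  have h9 : (k.total + k.shock) * s + k.total * -o
      = (k.total + k.shock) * a + (k.total + k.shock) * b + k.shock * o := by rw [h7]; ring
  linarith

lemma potential_small_small_to_small (ha : 0 < a) (hb : 0 < b)
    (h₁ : s - o = a + b) (h₂ : W s + W o = W a + W b) :
    k.potential .small s + k.total * |o| + 4 * C₀ * |o| ≤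
      k.potential .small a + k.potential .small b := by
  obtain ⟨ho, -⟩ := riemann_shock_shock ha hb h₁ h₂
  have h6 := mul_le_mul_of_nonneg_right k.shock_ge (neg_nonneg.mpr ho)
  have h7 : s = a + b + o := by linarith
  simp only [Coeffs.potential, abs_of_nonpos ho]
  have h9 : (k.total + k.shock) * s + k.total * -o
      = (k.total + k.shock) * a + (k.total + k.shock) * b + k.shock * o := by rw [h7]; ring
  linarith

lemma potential_small_small_to_big (hC₀ : 0 < C₀) (hε : 0 < ε) (ha : 0 < a) (hb : 0 < b)
    (hs : ε ≤ s) (h₁ : s - o = a + b) (h₂ : W s + W o = W a + W b) :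
    k.potential .big s + k.total * |o| - Real.log C₁ ≤
      k.potential .small a + k.potential .small b := by
  obtain ⟨ho, -⟩ := riemann_shock_shock ha hb h₁ h₂
  have h6 := mul_nonneg_of_nonpos_of_nonpos (show -k.shock ≤ 0 by linarith [k.shock_ge]) ho
  have h7 : s = a + b + o := by linarith
  have h5 : k.growth * ε ≤ k.growth * W s :=
    mul_le_mul_of_nonneg_left (hs.trans (le_W_of_nonneg (hε.le.trans hs)))
      (by linarith [k.growth_ge])
  have h8 := k.growth_mul_ge
  simp only [Coeffs.potential, abs_of_nonpos ho, max_eq_left (show ε - s ≤ 0 by linarith), mul_zero]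
  have h9 : (k.total + k.shock) * s + k.total * -o
      = (k.total + k.shock) * a + (k.total + k.shock) * b + k.shock * o := by rw [h7]; ring
  linarith

/-- The drop of the linear part of the potential when a shock meets a rarefaction; the loss
`a - max s 0` of the shock strength pays for the reflected shock. -/
lemma linear_shock_rarefaction (hC₀ : 0 < C₀) (ha : 0 < a) (haR : a ≤ R) (hη : 0 < η)
    (h₁ : s - o = a + -η) (h₂ : W s + W o = W a + W (-η)) :
    k.total * |s| + k.shock * max s 0 + (k.total + k.shock) * o + C₀ * o + 2 * C₀ * (a - max s 0)
      + (k.deficit + k.growth * Real.cosh (R / 2)) * (a - max s 0)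
      ≤ (k.total + k.shock) * a + k.total * η := by
  obtain ⟨ho, hsa, -, hF, hK⟩ := riemann_shock_rarefaction ha haR hη h₁ h₂
  have hl : 0 ≤ a - max s 0 := sub_nonneg.mpr (max_le hsa ha.le)
  set l := a - max s 0
  have hK1 := Real.one_le_cosh (R / 2)
  set K := Real.cosh (R / 2)
  have hS : 4 * C₀ ≤ k.shock := k.shock_ge
  have hG : 2 * C₀ ≤ k.growth := k.growth_ge
  have hD := k.deficit_nonneg
  have hT := k.total_ge
  have e1 : k.total * |s| + k.total * o = k.total * a + k.total * η - 2 * (k.total * l) := by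
    rw [← mul_add, hF]
    ring
  have e2 := mul_le_mul_of_nonneg_right hT hl
  have e3 : (k.shock + C₀) * o ≤ (k.shock + C₀) * (K * l) :=
    mul_le_mul_of_nonneg_left (by linarith) (by linarith)
  have e0 : 0 ≤ (k.shock + k.growth + C₀) * K := mul_nonneg (by linarith) (by linarith)
  have e4 : 0 ≤ k.total * l := mul_nonneg (by linarith) hl
  have e5 : 0 ≤ k.shock * l := mul_nonneg (by linarith) hl
  have e6 : max s 0 = a - l := by simp [l]
  rw [e6]
  linarith

lemma potential_big_rarefaction_to_big (hC₀ : 0 < C₀) (ha : 0 < a) (haR : a ≤ R)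
    (hη : 0 < η) (hs : 0 < s) (h₁ : s - o = a + -η) (h₂ : W s + W o = W a + W (-η)) :
    k.potential .big s + k.potential .small o + C₀ * o ≤
      k.potential .big a + k.potential .rarefaction η := by
  obtain ⟨ho, hsa, -, -, -⟩ := riemann_shock_rarefaction ha haR hη h₁ h₂
  have h := linear_shock_rarefaction k hC₀ ha haR hη h₁ h₂
  rw [abs_of_pos hs, max_eq_left hs.le] at h
  have h3 : max 0 (ε - s) ≤ max 0 (ε - a) + (a - s) :=
    max_le (add_nonneg (le_max_left _ _) (by linarith)) (by linarith [le_max_right 0 (ε - a)])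
  have h4 := mul_le_mul_of_nonneg_left h3 k.deficit_nonneg
  have h5 := mul_le_mul_of_nonneg_left (W_sub_le hs.le hsa haR)
    (show 0 ≤ k.growth by linarith [k.growth_ge])
  have h6 : 0 ≤ 2 * C₀ * (a - s) := mul_nonneg (by linarith) (by linarith)
  simp only [Coeffs.potential]
  linarith

lemma potential_big_rarefaction_to_small (hC₀ : 0 < C₀) (ha : 0 < a) (haR : a ≤ R)
    (hη : 0 < η) (hs : 0 < s) (hsε : s < ε / 2) (h₁ : s - o = a + -η)
    (h₂ : W s + W o = W a + W (-η)) :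
    k.potential .small s + k.potential .small o - Real.log C₁ ≤
      k.potential .big a + k.potential .rarefaction η := by
  obtain ⟨ho, hsa, -, -, -⟩ := riemann_shock_rarefaction ha haR hη h₁ h₂
  have h := linear_shock_rarefaction k hC₀ ha haR hη h₁ h₂
  rw [abs_of_pos hs, max_eq_left hs.le] at h
  have hG : 0 ≤ k.growth := by linarith [k.growth_ge]
  -- The deficit before the interaction and the loss `a - s` add up to at least `ε / 2`.
  have h4 := mul_le_mul_of_nonneg_left
    (show ε / 2 - (a - s) ≤ max 0 (ε - a) from le_trans (by linarith) (le_max_right 0 (ε - a)))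
    k.deficit_nonneg
  have h5 : W a ≤ Real.cosh (R / 2) * R := by
    have h5 := W_sub_le le_rfl ha.le haR
    rw [W_of_nonpos le_rfl, sub_zero, sub_zero] at h5
    exact h5.trans (mul_le_mul_of_nonneg_left haR (Real.cosh_pos _).le)
  have h5' := (mul_le_mul_of_nonneg_left h5 hG).trans k.deficit_ge
  have h6 : 0 ≤ 2 * C₀ * (a - s) := mul_nonneg (by linarith) (by linarith)
  have h7 : 0 ≤ C₀ * o := mul_nonneg hC₀.le ho
  have h8 : 0 ≤ k.growth * Real.cosh (R / 2) * (a - s) :=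
    mul_nonneg (mul_nonneg hG (Real.cosh_pos _).le) (by linarith)
  have h9 := k.count_ge
  simp only [Coeffs.potential]
  linarith

lemma potential_small_rarefaction (hC₀ : 0 < C₀) (ha : 0 < a) (haR : a ≤ R)
    (hη : 0 < η) (h₁ : s - o = a + -η) (h₂ : W s + W o = W a + W (-η)) :
    k.total * |s| + k.shock * max s 0 + k.potential .small o + C₀ * o + 2 * C₀ * (a - max s 0) ≤
      k.potential .small a + k.potential .rarefaction η := by
  obtain ⟨ho, hsa, -, -, -⟩ := riemann_shock_rarefaction ha haR hη h₁ h₂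
  have h := linear_shock_rarefaction k hC₀ ha haR hη h₁ h₂
  have h8 : 0 ≤ (k.deficit + k.growth * Real.cosh (R / 2)) * (a - max s 0) :=
    mul_nonneg (add_nonneg k.deficit_nonneg
      (mul_nonneg (by linarith [k.growth_ge]) (Real.cosh_pos _).le))
      (sub_nonneg.mpr (max_le hsa ha.le))
  simp only [Coeffs.potential]
  linarith

end Drop

/-! ### Fronts, fans and the effect of an interaction -/

/-- The standing assumptions on the parameters. -/
structure Params.Valid (c : Params) : Prop where
  C₀_pos : 0 < c.C₀
  C₁_pos : 0 < c.C₁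
  ε_pos : 0 < c.ε
  C₀_mul_ε_le : c.C₀ * c.ε ≤ 1 / 2
  C₁_le : c.C₁ ≤ (1 - c.C₀ * c.ε) ^ 2
  δ_pos : 0 < c.δ
  δ_lt : c.δ < c.ε / 2

lemma Params.Valid.C₁_lt_one {c : Params} (hc : c.Valid) : c.C₁ < 1 := by
  have h := mul_pos hc.C₀_pos hc.ε_pos
  nlinarith [hc.C₁_le, hc.C₀_mul_ε_le]

lemma Params.Valid.C₀_mul_le {c : Params} (hc : c.Valid) {s : ℝ} (h : s ≤ c.ε) :
    c.C₀ * s ≤ 1 / 2 :=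
  (mul_le_mul_of_nonneg_left h hc.C₀_pos.le).trans hc.C₀_mul_ε_le

/-- The restrictions on the strength of a front that the scheme preserves. -/
structure Front.Admissible (c : Params) (f : Front) : Prop where
  pos : 0 < f.strength
  big : f.label = .big → c.ε / 2 ≤ f.strength
  small : f.label = .small → f.strength < c.ε
  rarefaction : f.label = .rarefaction → f.strength ≤ c.δ

lemma Front.Admissible.ratio_pos {c : Params} (hc : c.Valid) {f : Front} (hf : f.Admissible c) :
    0 < f.ratio c := by
  have h := hf.pos
  have h₀ := hc.C₀_pos
  have h₁ := hc.C₁_pos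
  obtain ⟨i, lab, s⟩ := f
  cases lab <;> cases i <;> simp only [Front.ratio]
  · exact h₁
  · positivity
  · have := hc.C₀_mul_le (hf.small rfl).le
    simp only at this
    linarith
  · simp only at h
    positivity
  all_goals exact one_pos

section Fan

variable {c : Params} {i : Family} {lab : Label} {σ : ℝ}

lemma fan_of_pos (δ : ℝ) (hσ : 0 < σ) : fan δ i lab σ = [⟨i, lab, σ⟩] := if_pos hσ

lemma fan_of_nonpos {δ : ℝ} (hσ : σ ≤ 0) :
    fan δ i lab σ =
      List.replicate ⌈|σ| / δ⌉₊ ⟨i, .rarefaction, |σ| / (⌈|σ| / δ⌉₊ : ℝ)⟩ := by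
  unfold fan
  rw [if_neg (not_lt.mpr hσ)]
  split_ifs with h
  · rfl
  · have : σ = 0 := le_antisymm hσ (not_lt.mp h)
    simp [this]

/-- The rarefaction fronts of a fan share the strength of the wave, so that a quantity
proportional to the strength is preserved. -/
lemma sum_fan_of_nonpos {δ : ℝ} (hδ : 0 < δ) (hσ : σ ≤ 0) (g : Front → ℝ) (κ : ℝ)
    (hg : ∀ s, g ⟨i, .rarefaction, s⟩ = κ * s) : ((fan δ i lab σ).map g).sum = κ * |σ| := by
  rw [fan_of_nonpos hσ, List.map_replicate, List.sum_replicate, hg, nsmul_eq_mul]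
  rcases eq_or_ne σ 0 with rfl | h
  · simp
  · have : 0 < |σ| / δ := div_pos (abs_pos.mpr h) hδ
    have : (0 : ℝ) < ⌈|σ| / δ⌉₊ := by exact_mod_cast Nat.ceil_pos.mpr this
    field_simp

lemma sum_strength_fan {δ : ℝ} (hδ : 0 < δ) :
    ((fan δ i lab σ).map Front.strength).sum = |σ| := by
  rcases lt_or_ge 0 σ with h | h
  · simp [fan_of_pos δ h, abs_of_pos h]
  · rw [sum_fan_of_nonpos hδ h _ 1 (by simp), one_mul]

lemma prod_ratio_fan_of_nonpos {δ : ℝ} (hσ : σ ≤ 0) :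
    ((fan δ i lab σ).map (Front.ratio c)).prod = 1 := by
  rw [fan_of_nonpos hσ, List.map_replicate, List.prod_replicate]
  simp [Front.ratio]

lemma admissible_of_mem_fan (hδ : 0 < c.δ) (h : 0 < σ → (⟨i, lab, σ⟩ : Front).Admissible c) :
    ∀ f ∈ fan c.δ i lab σ, f.Admissible c := by
  intro f hf
  rcases lt_or_ge 0 σ with hσ | hσ
  · rw [fan_of_pos _ hσ, List.mem_singleton] at hf
    exact hf ▸ h hσ
  · rw [fan_of_nonpos hσ, List.mem_replicate] at hf
    obtain ⟨hn, rfl⟩ := hf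
    have hn : 0 < ⌈|σ| / c.δ⌉₊ := Nat.pos_of_ne_zero hn
    have hσ' : 0 < |σ| := (div_pos_iff_of_pos_right hδ).mp (Nat.ceil_pos.mp hn)
    have hn' : (0 : ℝ) < ⌈|σ| / c.δ⌉₊ := by exact_mod_cast hn
    refine ⟨div_pos hσ' hn', nofun, nofun, fun _ => ?_⟩
    rw [div_le_iff₀ hn', mul_comm]
    exact (div_le_iff₀ hδ).mp (Nat.le_ceil _)

end Fan

/-- The effect of replacing the fronts `l` by `l'` while the weight is multiplied by `m`: the total
strength does not increase, the weight does not increase on either side, and the logarithm of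
`m` is controlled by the drop of the potential. -/
structure StepBound (c : Params) {R : ℝ} (k : Coeffs c.C₀ c.C₁ c.ε R) (l l' : List Front) (m : ℝ) :
    Prop where
  admissible : ∀ f ∈ l', f.Admissible c
  strength_le : (l'.map Front.strength).sum ≤ (l.map Front.strength).sum
  le_one : m ≤ 1
  exp_le : Real.exp ((l'.map fun f => k.potential f.label f.strength).sum -
    (l.map fun f => k.potential f.label f.strength).sum) ≤ m
  ratio_le : m * (l'.map (Front.ratio c)).prod ≤ (l.map (Front.ratio c)).prod

section Step

variable {c : Params} {R : ℝ} {k : Coeffs c.C₀ c.C₁ c.ε R} {m : ℝ}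

lemma StepBound.perm {l₁ l₂ l₁' l₂' : List Front} (h : StepBound c k l₁ l₁' m) (hl : l₁.Perm l₂)
    (hl' : l₁'.Perm l₂') : StepBound c k l₂ l₂' m where
  admissible f hf := h.admissible f (hl'.mem_iff.mpr hf)
  strength_le := by
    rw [← (hl.map _).sum_eq, ← (hl'.map _).sum_eq]
    exact h.strength_le
  le_one := h.le_one
  exp_le := by
    rw [← (hl.map _).sum_eq, ← (hl'.map _).sum_eq]
    exact h.exp_le
  ratio_le := by
    rw [← (hl.map _).prod_eq, ← (hl'.map _).prod_eq]
    exact h.ratio_le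

lemma StepBound.refl {l : List Front} (h : ∀ f ∈ l, f.Admissible c) : StepBound c k l l 1 :=
  ⟨h, le_rfl, le_rfl, by simp, by simp⟩

variable {i j : Family} {la lb lab lo : Label} {a b s o e η : ℝ}

/-- The bound for the interaction of two shocks of one family, given the drop `e` of the
potential. -/
lemma StepBound.of_shock_shock (hc : c.Valid) (ha : 0 < a) (hb : 0 < b) (h₁ : s - o = a + b)
    (h₂ : W s + W o = W a + W b) (hs : (⟨i, lab, s⟩ : Front).Admissible c)
    (he : k.potential lab s + k.total * |o| + e ≤ k.potential la a + k.potential lb b)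
    (hm : Real.exp (-e) ≤ m) (hm' : m ≤ 1)
    (hr : m * Front.ratio c ⟨i, lab, s⟩ ≤ Front.ratio c ⟨i, la, a⟩ * Front.ratio c ⟨i, lb, b⟩) :
    StepBound c k [⟨i, la, a⟩, ⟨i, lb, b⟩] (fan c.δ i lab s ++ fan c.δ j lo o) m := by
  obtain ⟨ho, -, has, -⟩ := riemann_shock_shock ha hb h₁ h₂
  have hs' : 0 < s := ha.trans_le has
  refine ⟨?_, ?_, hm', le_trans (Real.exp_le_exp.mpr ?_) hm, ?_⟩
  · intro f hf
    rcases List.mem_append.mp hf with hf | hf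
    · exact admissible_of_mem_fan hc.δ_pos (fun _ => hs) f hf
    · exact admissible_of_mem_fan hc.δ_pos (fun h => absurd h (not_lt.mpr ho)) f hf
  · rw [List.map_append, List.sum_append, sum_strength_fan hc.δ_pos, sum_strength_fan hc.δ_pos,
      abs_of_pos hs', abs_of_nonpos ho]
    simp only [List.map_cons, List.map_nil, List.sum_cons, List.sum_nil]
    linarith
  · rw [List.map_append, List.sum_append,
      sum_fan_of_nonpos hc.δ_pos ho _ k.total (fun _ => rfl), fan_of_pos _ hs']
    simp only [List.map_cons, List.map_nil, List.sum_cons, List.sum_nil]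
    linarith
  · rw [List.map_append, List.prod_append, prod_ratio_fan_of_nonpos ho, fan_of_pos _ hs']
    simpa using hr

/-- The bound for the interaction of a shock and a rarefaction of one family, given the drop `e` of
the potential, if a shock of that family leaves it. -/
lemma StepBound.of_shock_rarefaction (hc : c.Valid) (ha : 0 < a) (haR : a ≤ R)
    (hη : (⟨i, .rarefaction, η⟩ : Front).Admissible c) (h₁ : s - o = a + -η)
    (h₂ : W s + W o = W a + W (-η)) (hs : (⟨i, lab, s⟩ : Front).Admissible c)
    (he : k.potential lab s + k.potential .small o + e ≤
      k.potential la a + k.potential .rarefaction η)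
    (hm : Real.exp (-e) ≤ m) (hm' : m ≤ 1)
    (hr : m * (Front.ratio c ⟨i, lab, s⟩ * Front.ratio c ⟨j, .small, o⟩) ≤
      Front.ratio c ⟨i, la, a⟩) :
    StepBound c k [⟨i, la, a⟩, ⟨i, .rarefaction, η⟩]
      (fan c.δ i lab s ++ fan c.δ j .small o) m := by
  obtain ⟨ho, hsa, hoη, -, -⟩ := riemann_shock_rarefaction ha haR hη.pos h₁ h₂
  have hs' : 0 < s := hs.pos
  have hηδ : η ≤ c.δ := hη.rarefaction rfl
  have hδ := hc.δ_lt
  have hε := hc.ε_pos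
  have hη0 : 0 < η := hη.pos
  have hoε : o < c.ε := by
    simp only at hoη
    linarith
  refine ⟨?_, ?_, hm', le_trans (Real.exp_le_exp.mpr ?_) hm, ?_⟩
  · intro f hf
    rcases List.mem_append.mp hf with hf | hf
    · exact admissible_of_mem_fan hc.δ_pos (fun _ => hs) f hf
    · exact admissible_of_mem_fan (i := j) (lab := .small) (σ := o) hc.δ_pos
        (fun h => ⟨h, nofun, fun _ => hoε, nofun⟩) f hf
  · rw [List.map_append, List.sum_append, sum_strength_fan hc.δ_pos, sum_strength_fan hc.δ_pos,
      abs_of_pos hs', abs_of_nonneg ho]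
    simp only [List.map_cons, List.map_nil, List.sum_cons, List.sum_nil]
    linarith
  · have : ((fan c.δ j .small o).map fun f => k.potential f.label f.strength).sum
        = k.potential .small o := by
      rcases ho.eq_or_lt with rfl | ho
      · simp [fan, Coeffs.potential]
      · simp [fan_of_pos _ ho]
    rw [List.map_append, List.sum_append, this, fan_of_pos _ hs']
    simp only [List.map_cons, List.map_nil, List.sum_cons, List.sum_nil]
    linarith
  · have : ((fan c.δ j .small o).map (Front.ratio c)).prod = Front.ratio c ⟨j, .small, o⟩ := by
      rcases ho.eq_or_lt with rfl | ho
      · cases j <;> simp [fan, Front.ratio]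
      · simp [fan_of_pos _ ho]
    rw [List.map_append, List.prod_append, this, fan_of_pos _ hs']
    simpa [Front.ratio] using hr

/-- The bound for the interaction of a small shock and a rarefaction of one family, if a rarefaction
of that family leaves it. -/
lemma StepBound.of_small_rarefaction (hc : c.Valid) (ha : 0 < a) (haR : a ≤ R)
    (hη : (⟨i, .rarefaction, η⟩ : Front).Admissible c) (h₁ : s - o = a + -η)
    (h₂ : W s + W o = W a + W (-η)) (hs : s ≤ 0)
    (hm : Real.exp (-(c.C₀ * o + 2 * c.C₀ * a)) ≤ m) (hm' : m ≤ 1)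
    (hr : m * Front.ratio c ⟨j, .small, o⟩ ≤ Front.ratio c ⟨i, .small, a⟩) :
    StepBound c k [⟨i, .small, a⟩, ⟨i, .rarefaction, η⟩]
      (fan c.δ i lab s ++ fan c.δ j .small o) m := by
  obtain ⟨ho, hsa, hoη, hF, -⟩ := riemann_shock_rarefaction ha haR hη.pos h₁ h₂
  have he := potential_small_rarefaction k hc.C₀_pos ha haR hη.pos h₁ h₂
  rw [max_eq_right hs] at he hF
  have hηδ : η ≤ c.δ := hη.rarefaction rfl
  have hδ := hc.δ_lt
  have hε := hc.ε_pos
  have hη0 : 0 < η := hη.pos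
  have hoε : o < c.ε := by
    simp only at hoη
    linarith
  refine ⟨?_, ?_, hm', le_trans (Real.exp_le_exp.mpr ?_) hm, ?_⟩
  · intro f hf
    rcases List.mem_append.mp hf with hf | hf
    · exact admissible_of_mem_fan hc.δ_pos (fun h => absurd h (not_lt.mpr hs)) f hf
    · exact admissible_of_mem_fan (i := j) (lab := .small) (σ := o) hc.δ_pos
        (fun h => ⟨h, nofun, fun _ => hoε, nofun⟩) f hf
  · rw [List.map_append, List.sum_append, sum_strength_fan hc.δ_pos, sum_strength_fan hc.δ_pos,
      abs_of_nonneg ho]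
    simp only [List.map_cons, List.map_nil, List.sum_cons, List.sum_nil]
    linarith
  · have : ((fan c.δ j .small o).map fun f => k.potential f.label f.strength).sum
        = k.potential .small o := by
      rcases ho.eq_or_lt with rfl | ho
      · simp [fan, Coeffs.potential]
      · simp [fan_of_pos _ ho]
    rw [List.map_append, List.sum_append, this,
      sum_fan_of_nonpos hc.δ_pos hs _ k.total (fun _ => rfl)]
    simp only [List.map_cons, List.map_nil, List.sum_cons, List.sum_nil]
    linarith
  · have : ((fan c.δ j .small o).map (Front.ratio c)).prod = Front.ratio c ⟨j, .small, o⟩ := by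
      rcases ho.eq_or_lt with rfl | ho
      · cases j <;> simp [fan, Front.ratio]
      · simp [fan_of_pos _ ho]
    rw [List.map_append, List.prod_append, this, prod_ratio_fan_of_nonpos hs, one_mul]
    simpa [Front.ratio] using hr

lemma StepBound.of_rarefaction_rarefaction (hc : c.Valid) (ha : 0 < a) (hb : 0 < b)
    (h₁ : s - o = -a + -b) (h₂ : W s + W o = W (-a) + W (-b)) :
    StepBound c k [⟨i, .rarefaction, a⟩, ⟨i, .rarefaction, b⟩]
      (fan c.δ i lab s ++ fan c.δ j lo o) 1 := by
  obtain ⟨rfl, rfl⟩ := riemann_rarefaction_rarefaction (neg_neg_of_pos ha) (neg_neg_of_pos hb) h₁ h₂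
  have hs : -a + -b ≤ 0 := by linarith
  have h0 : fan c.δ j lo 0 = [] := by simp [fan]
  rw [h0, List.append_nil]
  refine ⟨admissible_of_mem_fan hc.δ_pos (fun h => absurd h (not_lt.mpr hs)), ?_, le_rfl, ?_, ?_⟩
  · rw [sum_strength_fan hc.δ_pos, abs_of_nonpos hs]
    simp only [List.map_cons, List.map_nil, List.sum_cons, List.sum_nil]
    linarith
  · rw [sum_fan_of_nonpos hc.δ_pos hs _ k.total (fun _ => rfl), abs_of_nonpos hs]
    simp only [List.map_cons, List.map_nil, List.sum_cons, List.sum_nil, Coeffs.potential]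
    apply le_of_eq
    rw [← Real.exp_zero]
    congr 1
    ring
  · rw [prod_ratio_fan_of_nonpos hs]
    simp [Front.ratio]

end Step

/-! ### The types of interactions -/

lemma exp_neg_le_one_div {x : ℝ} (hx : 0 ≤ x) : Real.exp (-x) ≤ 1 / (1 + x) := by
  rw [Real.exp_neg, ← one_div]
  exact one_div_le_one_div_of_le (by linarith) (by linarith [Real.add_one_le_exp x])

lemma exp_neg_two_mul_le {x : ℝ} (hx : 0 ≤ x) (hx' : x ≤ 1 / 2) : Real.exp (-(2 * x)) ≤ 1 - x := by
  refine (exp_neg_le_one_div (by linarith)).trans ?_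
  rw [div_le_iff₀ (by linarith)]
  nlinarith

section Types

variable {c : Params} {R : ℝ} {k : Coeffs c.C₀ c.C₁ c.ε R} {i j : Family} {lo : Label}
  {a b s o η : ℝ}

lemma stepBound_big_big (hc : c.Valid) (ha : (⟨i, .big, a⟩ : Front).Admissible c)
    (hb : (⟨i, .big, b⟩ : Front).Admissible c) (h₁ : s - o = a + b)
    (h₂ : W s + W o = W a + W b) :
    StepBound c k [⟨i, .big, a⟩, ⟨i, .big, b⟩] (fan c.δ i .big s ++ fan c.δ j lo o)
      (match i with | .one => c.C₁ | .two => 1) := by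
  have hq := Real.log_nonpos hc.C₁_pos.le hc.C₁_lt_one.le
  obtain ⟨-, -, has, -⟩ := riemann_shock_shock ha.pos hb.pos h₁ h₂
  refine .of_shock_shock (e := -Real.log c.C₁) hc ha.pos hb.pos h₁ h₂
    ⟨ha.pos.trans_le has, fun _ => (ha.big rfl).trans has, nofun, nofun⟩
    (potential_big_big k hc.C₀_pos ha.pos hb.pos h₁ h₂) ?_ ?_ ?_
  · rw [neg_neg, Real.exp_log hc.C₁_pos]
    cases i
    exacts [le_rfl, hc.C₁_lt_one.le]
  · cases i
    exacts [hc.C₁_lt_one.le, le_rfl]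
  · cases i
    · exact le_rfl
    · have : 1 ≤ 1 / c.C₁ := (one_le_div hc.C₁_pos).mpr hc.C₁_lt_one.le
      simp only [Front.ratio]
      nlinarith

lemma stepBound_big_small (hc : c.Valid) (ha : (⟨i, .big, a⟩ : Front).Admissible c)
    (hb : (⟨i, .small, b⟩ : Front).Admissible c) (h₁ : s - o = a + b)
    (h₂ : W s + W o = W a + W b) :
    StepBound c k [⟨i, .big, a⟩, ⟨i, .small, b⟩] (fan c.δ i .big s ++ fan c.δ j lo o)
      (match i with | .one => 1 - c.C₀ * b | .two => 1) := by
  obtain ⟨-, -, has, -⟩ := riemann_shock_shock ha.pos hb.pos h₁ h₂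
  have hb0 : 0 < c.C₀ * b := mul_pos hc.C₀_pos hb.pos
  have hb1 := hc.C₀_mul_le (hb.small rfl).le
  have h := exp_neg_two_mul_le hb0.le hb1
  simp only at hb1 h
  refine .of_shock_shock (e := 2 * (c.C₀ * b)) hc ha.pos hb.pos h₁ h₂
    ⟨ha.pos.trans_le has, fun _ => (ha.big rfl).trans has, nofun, nofun⟩ ?_ ?_ ?_ ?_
  · have := potential_big_small k hc.C₀_pos ha.pos hb.pos h₁ h₂
    simp only at this
    linarith
  · cases i <;> dsimp only <;> linarith
  · cases i <;> dsimp only <;> linarith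
  · cases i
    · simp only [Front.ratio]
      exact (mul_comm _ _).le
    · have : 0 < 1 / c.C₁ := one_div_pos.mpr hc.C₁_pos
      simp only [Front.ratio]
      nlinarith

lemma stepBound_small_small_to_small (hc : c.Valid) (ha : (⟨i, .small, a⟩ : Front).Admissible c)
    (hb : (⟨i, .small, b⟩ : Front).Admissible c) (hs : s < c.ε) (h₁ : s - o = a + b)
    (h₂ : W s + W o = W a + W b) :
    StepBound c k [⟨i, .small, a⟩, ⟨i, .small, b⟩] (fan c.δ i .small s ++ fan c.δ j lo o)
      (match i with
        | .one => min ((1 - c.C₀ * a) * (1 - c.C₀ * b) / (1 - c.C₀ * s)) 1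
        | .two => 1) := by
  obtain ⟨ho, -, has, -⟩ := riemann_shock_shock ha.pos hb.pos h₁ h₂
  have ha0 : 0 < c.C₀ * a := mul_pos hc.C₀_pos ha.pos
  have hb0 : 0 < c.C₀ * b := mul_pos hc.C₀_pos hb.pos
  have ha1 : c.C₀ * a ≤ 1 / 2 := hc.C₀_mul_le (ha.small rfl).le
  have hb1 : c.C₀ * b ≤ 1 / 2 := hc.C₀_mul_le (hb.small rfl).le
  have hs1 : c.C₀ * s ≤ 1 / 2 := hc.C₀_mul_le hs.le
  have ho1 : 0 ≤ c.C₀ * |o| := mul_nonneg hc.C₀_pos.le (abs_nonneg o)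
  -- The factor falls below `1` only through the reflected rarefaction, of strength `|o|`.
  have hsum : c.C₀ * s = c.C₀ * a + c.C₀ * b - c.C₀ * |o| := by
    rw [abs_of_nonpos ho, ← mul_add, ← mul_sub]
    congr 1
    linarith
  refine .of_shock_shock (e := 4 * (c.C₀ * |o|)) hc ha.pos hb.pos h₁ h₂
    ⟨ha.pos.trans_le has, nofun, fun _ => hs, nofun⟩ ?_ ?_ ?_ ?_
  · have := potential_small_small_to_small k ha.pos hb.pos h₁ h₂
    simp only at this
    linarith
  · have hle : Real.exp (-(4 * (c.C₀ * |o|))) ≤ 1 := Real.exp_le_one_iff.mpr (by linarith)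
    cases i
    · refine le_min ((exp_neg_le_one_div (by linarith)).trans ?_) hle
      rw [div_le_div_iff₀ (by linarith) (by linarith), hsum]
      have h4 : 1 / 4 ≤ (1 - c.C₀ * a) * (1 - c.C₀ * b) := by nlinarith
      nlinarith [mul_le_mul_of_nonneg_right h4 ho1, mul_pos ha0 hb0]
    · exact hle
  · cases i
    exacts [min_le_right _ _, le_rfl]
  · cases i
    · simp only [Front.ratio]
      exact (mul_le_mul_of_nonneg_right (min_le_left _ _) (by linarith)).trans
        (div_mul_cancel₀ _ (by linarith)).le
    · simp only [Front.ratio]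
      nlinarith [mul_pos ha0 hb0]

lemma stepBound_small_small_to_big (hc : c.Valid) (ha : (⟨i, .small, a⟩ : Front).Admissible c)
    (hb : (⟨i, .small, b⟩ : Front).Admissible c) (hs : c.ε ≤ s) (h₁ : s - o = a + b)
    (h₂ : W s + W o = W a + W b) :
    StepBound c k [⟨i, .small, a⟩, ⟨i, .small, b⟩] (fan c.δ i .big s ++ fan c.δ j lo o)
      (match i with | .one => 1 | .two => c.C₁) := by
  have hq := Real.log_nonpos hc.C₁_pos.le hc.C₁_lt_one.le
  have ha0 : 0 < c.C₀ * a := mul_pos hc.C₀_pos ha.pos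
  have hb0 : 0 < c.C₀ * b := mul_pos hc.C₀_pos hb.pos
  have hε := hc.ε_pos
  refine .of_shock_shock (e := -Real.log c.C₁) hc ha.pos hb.pos h₁ h₂
    ⟨hc.ε_pos.trans_le hs, fun _ => by simp only; linarith, nofun, nofun⟩
    (potential_small_small_to_big k hc.C₀_pos hc.ε_pos ha.pos hb.pos hs h₁ h₂) ?_ ?_ ?_
  · rw [neg_neg, Real.exp_log hc.C₁_pos]
    cases i
    exacts [hc.C₁_lt_one.le, le_rfl]
  · cases i
    exacts [le_rfl, hc.C₁_lt_one.le]
  · cases i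
    · have ha1 : c.C₀ * a ≤ c.C₀ * c.ε := mul_le_mul_of_nonneg_left (ha.small rfl).le hc.C₀_pos.le
      have hb1 : c.C₀ * b ≤ c.C₀ * c.ε := mul_le_mul_of_nonneg_left (hb.small rfl).le hc.C₀_pos.le
      have := hc.C₀_mul_ε_le
      simp only [Front.ratio, one_mul]
      refine hc.C₁_le.trans ?_
      rw [sq]
      exact mul_le_mul (by linarith) (by linarith) (by linarith) (by linarith)
    · simp only [Front.ratio]
      rw [mul_one_div_cancel hc.C₁_pos.ne']
      nlinarith

lemma stepBound_big_rarefaction_to_big (hc : c.Valid) (hij : i ≠ j)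
    (ha : (⟨i, .big, a⟩ : Front).Admissible c) (haR : a ≤ R)
    (hη : (⟨i, .rarefaction, η⟩ : Front).Admissible c) (hs : c.ε / 2 ≤ s) (h₁ : s - o = a + -η)
    (h₂ : W s + W o = W a + W (-η)) :
    StepBound c k [⟨i, .big, a⟩, ⟨i, .rarefaction, η⟩] (fan c.δ i .big s ++ fan c.δ j .small o)
      (match i with | .one => 1 / (1 + c.C₀ * o) | .two => 1) := by
  have hs0 : 0 < s := lt_of_lt_of_le (by linarith [hc.ε_pos]) hs
  obtain ⟨ho, -⟩ := riemann_shock_rarefaction ha.pos haR hη.pos h₁ h₂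
  have ho0 : 0 ≤ c.C₀ * o := mul_nonneg hc.C₀_pos.le ho
  refine .of_shock_rarefaction (e := c.C₀ * o) hc ha.pos haR hη h₁ h₂
    ⟨hs0, fun _ => hs, nofun, nofun⟩
    (potential_big_rarefaction_to_big k hc.C₀_pos ha.pos haR hη.pos hs0 h₁ h₂) ?_ ?_ ?_
  · cases i
    · exact exp_neg_le_one_div ho0
    · exact Real.exp_le_one_iff.mpr (by linarith)
  · cases i
    · exact (div_le_one (by linarith)).mpr (by linarith)
    · exact le_rfl
  · cases i <;> cases j <;> simp only [ne_eq, not_true_eq_false, reduceCtorEq] at hij <;>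
      simp only [Front.ratio]
    · apply le_of_eq
      field_simp
    · have : 0 < 1 / c.C₁ := one_div_pos.mpr hc.C₁_pos
      nlinarith

/-- As the rarefaction is weaker than `ε / 2`, the shock survives the interaction and leaves it
stronger than the reflected shock; hence the ratios `1 - C₀ s` and `1 + C₀ o` multiply to at most
`1`. -/
lemma stepBound_big_rarefaction_to_small (hc : c.Valid) (hij : i ≠ j)
    (ha : (⟨i, .big, a⟩ : Front).Admissible c) (haR : a ≤ R)
    (hη : (⟨i, .rarefaction, η⟩ : Front).Admissible c) (hs : s < c.ε / 2) (h₁ : s - o = a + -η)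
    (h₂ : W s + W o = W a + W (-η)) :
    StepBound c k [⟨i, .big, a⟩, ⟨i, .rarefaction, η⟩] (fan c.δ i .small s ++ fan c.δ j .small o)
      (match i with | .one => c.C₁ | .two => 1) := by
  obtain ⟨ho, -⟩ := riemann_shock_rarefaction ha.pos haR hη.pos h₁ h₂
  have hε := hc.ε_pos
  have hos : o < s := by
    have h3 : c.ε / 2 ≤ a := ha.big rfl
    have h4 : η ≤ c.δ := hη.rarefaction rfl
    linarith [hc.δ_lt]
  have hs0 : 0 < s := ho.trans_lt hos
  have ho0 : 0 ≤ c.C₀ * o := mul_nonneg hc.C₀_pos.le ho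
  have hos' : c.C₀ * o ≤ c.C₀ * s := mul_le_mul_of_nonneg_left hos.le hc.C₀_pos.le
  have hs1 : c.C₀ * s ≤ 1 / 2 := hc.C₀_mul_le (by linarith)
  have hq := Real.log_nonpos hc.C₁_pos.le hc.C₁_lt_one.le
  refine .of_shock_rarefaction (e := -Real.log c.C₁) hc ha.pos haR hη h₁ h₂
    ⟨hs0, nofun, fun _ => by simp only; linarith, nofun⟩
    (potential_big_rarefaction_to_small k hc.C₀_pos ha.pos haR hη.pos hs0 hs h₁ h₂) ?_ ?_ ?_
  · rw [neg_neg, Real.exp_log hc.C₁_pos]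
    cases i
    exacts [le_rfl, hc.C₁_lt_one.le]
  · cases i
    exacts [hc.C₁_lt_one.le, le_rfl]
  · cases i <;> cases j <;> simp only [ne_eq, not_true_eq_false, reduceCtorEq] at hij <;>
      simp only [Front.ratio]
    · apply mul_le_of_le_one_right hc.C₁_pos.le
      nlinarith
    · have h1 : 1 + c.C₀ * c.ε ≤ 1 / c.C₁ := by
        rw [le_div_iff₀ hc.C₁_pos]
        have h2 := mul_pos hc.C₀_pos hc.ε_pos
        have h3 := hc.C₁_le
        have h4 := hc.C₀_mul_ε_le
        have h5 : (1 + c.C₀ * c.ε) * (1 - c.C₀ * c.ε) ^ 2 ≤ 1 := by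
          have h6 := mul_nonneg (sq_nonneg (c.C₀ * c.ε)) (show 0 ≤ 1 - c.C₀ * c.ε by linarith)
          linarith
        exact (mul_le_mul_of_nonneg_left h3 (by linarith)).trans h5
      have h6 : c.C₀ * s ≤ c.C₀ * c.ε := mul_le_mul_of_nonneg_left (by linarith) hc.C₀_pos.le
      nlinarith

lemma stepBound_small_rarefaction_to_small (hc : c.Valid) (hij : i ≠ j)
    (ha : (⟨i, .small, a⟩ : Front).Admissible c) (haR : a ≤ R)
    (hη : (⟨i, .rarefaction, η⟩ : Front).Admissible c) (hs : 0 < s) (h₁ : s - o = a + -η)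
    (h₂ : W s + W o = W a + W (-η)) :
    StepBound c k [⟨i, .small, a⟩, ⟨i, .rarefaction, η⟩]
      (fan c.δ i .small s ++ fan c.δ j .small o)
      (match i with
        | .one => (1 - c.C₀ * a) / ((1 - c.C₀ * s) * (1 + c.C₀ * o))
        | .two => 1) := by
  obtain ⟨ho, hsa, hoη, -, -⟩ := riemann_shock_rarefaction ha.pos haR hη.pos h₁ h₂
  simp only at hsa hoη
  have haε : a < c.ε := ha.small rfl
  have hC := hc.C₀_pos
  have hε := hc.ε_pos
  have ho0 : 0 ≤ c.C₀ * o := mul_nonneg hC.le ho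
  have hs0 : 0 < c.C₀ * s := mul_pos hC hs
  have hl0 : c.C₀ * s ≤ c.C₀ * a := mul_le_mul_of_nonneg_left hsa hC.le
  have ha1 : c.C₀ * a ≤ 1 / 2 := hc.C₀_mul_le haε.le
  have he := potential_small_rarefaction k hC ha.pos haR hη.pos h₁ h₂
  rw [abs_of_pos hs, max_eq_left hs.le] at he
  simp only at he
  have hexp : Real.exp (-(2 * (c.C₀ * a - c.C₀ * s))) * (1 - c.C₀ * s) ≤ 1 - c.C₀ * a := by
    refine (mul_le_mul_of_nonneg_right (exp_neg_le_one_div (by linarith)) (by linarith)).trans ?_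
    rw [one_div_mul_eq_div, div_le_iff₀ (by linarith)]
    nlinarith
  -- This makes the factor at most `1`: the product below is bounded by the strength of the
  -- rarefaction, which enters `(1 - C₀ s) (1 + C₀ o)` linearly.
  have hprod : c.C₀ * o * (c.C₀ * s) ≤ c.C₀ * η * (1 / 2) :=
    mul_le_mul (mul_le_mul_of_nonneg_left hoη hC.le) (by linarith) hs0.le
      (mul_nonneg hC.le (le_trans ho hoη))
  have hsum : c.C₀ * s - c.C₀ * o = c.C₀ * a - c.C₀ * η := by
    rw [← mul_sub, ← mul_sub]
    congr 1
  refine .of_shock_rarefaction (e := c.C₀ * o + 2 * (c.C₀ * a - c.C₀ * s)) hc ha.pos haR hη h₁ h₂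
    ⟨hs, nofun, fun _ => hsa.trans_lt haε, nofun⟩ ?_ ?_ ?_ ?_
  · have : k.potential .small s = k.total * s + k.shock * s := by
      simp only [Coeffs.potential]
      ring
    rw [this]
    linarith
  · cases i
    · dsimp only
      rw [neg_add, Real.exp_add, le_div_iff₀ (mul_pos (by linarith) (by linarith))]
      have h3 := exp_neg_le_one_div ho0
      rw [le_div_iff₀ (by linarith)] at h3
      have := mul_le_mul h3 hexp (mul_nonneg (Real.exp_pos _).le (by linarith)) zero_le_one
      linarith
    · exact Real.exp_le_one_iff.mpr (by linarith)
  · cases i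
    · dsimp only
      rw [div_le_one (mul_pos (by linarith) (by linarith))]
      nlinarith
    · exact le_rfl
  · cases i <;> cases j <;> simp only [ne_eq, not_true_eq_false, reduceCtorEq] at hij <;>
      simp only [Front.ratio]
    · exact (div_mul_cancel₀ _ (mul_pos (by linarith) (by linarith)).ne').le
    · nlinarith

lemma stepBound_small_rarefaction_to_rarefaction (hc : c.Valid) (hij : i ≠ j)
    (ha : (⟨i, .small, a⟩ : Front).Admissible c) (haR : a ≤ R)
    (hη : (⟨i, .rarefaction, η⟩ : Front).Admissible c) (hs : s ≤ 0) (h₁ : s - o = a + -η)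
    (h₂ : W s + W o = W a + W (-η)) :
    StepBound c k [⟨i, .small, a⟩, ⟨i, .rarefaction, η⟩]
      (fan c.δ i .small s ++ fan c.δ j .small o)
      (match i with
        | .one => (1 - c.C₀ * a) / (1 + c.C₀ * o)
        | .two => 1) := by
  obtain ⟨ho, -⟩ := riemann_shock_rarefaction ha.pos haR hη.pos h₁ h₂
  have ho0 : 0 ≤ c.C₀ * o := mul_nonneg hc.C₀_pos.le ho
  have ha0 : 0 < c.C₀ * a := mul_pos hc.C₀_pos ha.pos
  have ha1 : c.C₀ * a ≤ 1 / 2 := hc.C₀_mul_le (ha.small rfl).le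
  refine .of_small_rarefaction hc ha.pos haR hη h₁ h₂ hs ?_ ?_ ?_
  · cases i
    · dsimp only
      rw [neg_add, Real.exp_add, mul_assoc 2, div_eq_mul_one_div, mul_comm (1 - c.C₀ * a)]
      exact mul_le_mul (exp_neg_le_one_div ho0) (exp_neg_two_mul_le ha0.le ha1)
        (Real.exp_pos _).le (by positivity)
    · refine Real.exp_le_one_iff.mpr ?_
      linarith
  · cases i
    · exact (div_le_one (by linarith)).mpr (by linarith)
    · exact le_rfl
  · cases i <;> cases j <;> simp only [ne_eq, not_true_eq_false, reduceCtorEq] at hij <;>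
      simp only [Front.ratio]
    · exact (div_mul_cancel₀ _ (by linarith)).le
    · linarith

end Types

/-- Every interaction of admissible fronts decreases the weight on both sides, at the expense of the
potential. -/
theorem Collision.stepBound {c : Params} {R : ℝ} (k : Coeffs c.C₀ c.C₁ c.ε R) (hc : c.Valid)
    (κ : Collision) (hp : κ.p.toFront.Admissible c) (hq : κ.q.toFront.Admissible c)
    (hpR : κ.p.strength ≤ R) (hqR : κ.q.strength ≤ R) {z : ℝ × ℝ}
    (h : SolvesRiemann z (waveCurve κ.q.fam κ.q.toFront.signed
      (waveCurve κ.p.fam κ.p.toFront.signed z)) κ.σ₁ κ.σ₂) :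
    StepBound c k [κ.p.toFront, κ.q.toFront]
      (outgoing c.ε c.δ κ.p.toFront κ.q.toFront κ.σ₁ κ.σ₂)
      (c.C₁ ^ (κ.type c.ε).jumpL * κ.factor c) := by
  obtain ⟨left, ⟨⟨pf, pl, a⟩, pp⟩, ⟨⟨qf, ql, b⟩, qp⟩, right, s₁, s₂, out⟩ := κ
  simp only at hp hq hpR hqR h
  have hpass : ∀ l, l.Perm [(⟨pf, pl, a⟩ : Front), ⟨qf, ql, b⟩] →
      StepBound c k [⟨pf, pl, a⟩, ⟨qf, ql, b⟩] l 1 := fun l hl =>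
    (StepBound.refl (by simpa using ⟨hp, hq⟩)).perm .rfl hl.symm
  cases pf <;> cases qf
  case one.two =>
    simpa [Collision.type, Collision.factor, interactionType, outgoing,
      InteractionType.jumpL] using hpass _ .rfl
  case two.one =>
    simpa [Collision.type, Collision.factor, interactionType, outgoing,
      InteractionType.jumpL] using hpass _ (.swap _ _ _)
  case one.one =>
    simp only [SolvesRiemann, waveCurve, Prod.mk.injEq] at h
    obtain ⟨h₁, h₂⟩ : s₁ - s₂ = Front.signed ⟨.one, pl, a⟩ + Front.signed ⟨.one, ql, b⟩ ∧
        W s₁ + W s₂ = W (Front.signed ⟨.one, pl, a⟩) + W (Front.signed ⟨.one, ql, b⟩) :=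
      ⟨by linarith [h.1], by linarith [h.2]⟩
    have h₁' := h₁.trans (add_comm _ _)
    have h₂' := h₂.trans (add_comm _ _)
    have hij : Family.one ≠ Family.two := nofun
    cases pl <;> cases ql <;>
      simp only [Front.signed] at h₁ h₂ h₁' h₂' <;>
      simp only [Collision.type, Collision.factor, interactionType, outgoing, smallStrength] <;>
      (try split_ifs with hs) <;>
      simp only [InteractionType.jumpL, outLabelOne, outLabelTwo, pow_one, pow_zero, one_mul,
        mul_one]
    · exact stepBound_big_big hc hp hq h₁ h₂
    · exact stepBound_big_small hc hp hq h₁ h₂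
    · exact stepBound_big_rarefaction_to_big hc hij hp hpR hq hs h₁ h₂
    · exact stepBound_big_rarefaction_to_small hc hij hp hpR hq (not_le.mp hs) h₁ h₂
    · exact (stepBound_big_small hc hq hp h₁' h₂').perm (.swap _ _ _) .rfl
    · exact stepBound_small_small_to_small hc hp hq hs h₁ h₂
    · exact stepBound_small_small_to_big hc hp hq (not_lt.mp hs) h₁ h₂
    · exact stepBound_small_rarefaction_to_small hc hij hp hpR hq hs h₁ h₂
    · exact stepBound_small_rarefaction_to_rarefaction hc hij hp hpR hq (not_lt.mp hs) h₁ h₂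
    · exact (stepBound_big_rarefaction_to_big hc hij hq hqR hp hs h₁' h₂').perm (.swap _ _ _) .rfl
    · exact (stepBound_big_rarefaction_to_small hc hij hq hqR hp (not_le.mp hs) h₁' h₂').perm (.swap _ _ _) .rfl
    · exact (stepBound_small_rarefaction_to_small hc hij hq hqR hp hs h₁' h₂').perm (.swap _ _ _) .rfl
    · exact (stepBound_small_rarefaction_to_rarefaction hc hij hq hqR hp (not_lt.mp hs) h₁' h₂').perm (.swap _ _ _) .rfl
    · exact .of_rarefaction_rarefaction hc hp.pos hq.pos h₁ h₂
  case two.two =>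
    simp only [SolvesRiemann, waveCurve, Prod.mk.injEq] at h
    obtain ⟨h₁, h₂⟩ : s₂ - s₁ = Front.signed ⟨.two, pl, a⟩ + Front.signed ⟨.two, ql, b⟩ ∧
        W s₂ + W s₁ = W (Front.signed ⟨.two, pl, a⟩) + W (Front.signed ⟨.two, ql, b⟩) :=
      ⟨by linarith [h.1], by linarith [h.2]⟩
    have h₁' := h₁.trans (add_comm _ _)
    have h₂' := h₂.trans (add_comm _ _)
    have hij : Family.two ≠ Family.one := nofun
    cases pl <;> cases ql <;>
      simp only [Front.signed] at h₁ h₂ h₁' h₂' <;>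
      simp only [Collision.type, Collision.factor, interactionType, outgoing, smallStrength] <;>
      (try split_ifs with hs) <;>
      simp only [InteractionType.jumpL, outLabelOne, outLabelTwo, pow_one, pow_zero,
        mul_one]
    · exact (stepBound_big_big hc hp hq h₁ h₂).perm (.rfl) List.perm_append_comm
    · exact (stepBound_big_small hc hp hq h₁ h₂).perm (.rfl) List.perm_append_comm
    · exact (stepBound_big_rarefaction_to_big hc hij hp hpR hq hs h₁ h₂).perm (.rfl) List.perm_append_comm
    · exact (stepBound_big_rarefaction_to_small hc hij hp hpR hq (not_le.mp hs) h₁ h₂).perm (.rfl) List.perm_append_comm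
    · exact (stepBound_big_small hc hq hp h₁' h₂').perm (.swap _ _ _) List.perm_append_comm
    · exact (stepBound_small_small_to_small hc hp hq hs h₁ h₂).perm (.rfl) List.perm_append_comm
    · exact (stepBound_small_small_to_big hc hp hq (not_lt.mp hs) h₁ h₂).perm (.rfl) List.perm_append_comm
    · exact (stepBound_small_rarefaction_to_small hc hij hp hpR hq hs h₁ h₂).perm (.rfl) List.perm_append_comm
    · exact (stepBound_small_rarefaction_to_rarefaction hc hij hp hpR hq (not_lt.mp hs) h₁ h₂).perm (.rfl) List.perm_append_comm
    · exact (stepBound_big_rarefaction_to_big hc hij hq hqR hp hs h₁' h₂').perm (.swap _ _ _) List.perm_append_comm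
    · exact (stepBound_big_rarefaction_to_small hc hij hq hqR hp (not_le.mp hs) h₁' h₂').perm (.swap _ _ _) List.perm_append_comm
    · exact (stepBound_small_rarefaction_to_small hc hij hq hqR hp hs h₁' h₂').perm (.swap _ _ _) List.perm_append_comm
    · exact (stepBound_small_rarefaction_to_rarefaction hc hij hq hqR hp (not_lt.mp hs) h₁' h₂').perm (.swap _ _ _) List.perm_append_comm
    · exact (StepBound.of_rarefaction_rarefaction hc hp.pos hq.pos h₁ h₂).perm .rfl
        List.perm_append_comm

/-! ### Bounds in terms of the total strength -/

/-- The potential of a front is at most proportional to its strength. -/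
lemma Coeffs.exists_abs_potential_le {C₀ C₁ ε R : ℝ} (k : Coeffs C₀ C₁ ε R) (hC₀ : 0 < C₀)
    (hC₁ : 0 < C₁) (hC₁' : C₁ ≤ 1) (hε : 0 < ε) :
    ∃ A : ℝ, 0 ≤ A ∧ ∀ (lab : Label) (s : ℝ), 0 < s → s ≤ R → (lab = .big → ε / 2 ≤ s) →
      |k.potential lab s| ≤ A * s := by
  have hS : 0 ≤ k.shock := by linarith [k.shock_ge]
  have hG : 0 ≤ k.growth := by linarith [k.growth_ge]
  have hD := k.deficit_nonneg
  have hN : 0 ≤ k.count := by linarith [k.count_ge, Real.log_nonpos hC₁.le hC₁']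
  have hK := Real.cosh_pos (R / 2)
  have hT : 0 ≤ k.total := by
    have := mul_nonneg (show 0 ≤ k.shock + k.growth + C₀ by linarith) hK.le
    linarith [k.total_ge]
  refine ⟨k.total + k.shock + 2 * k.deficit + k.growth * Real.cosh (R / 2) + 2 * k.count / ε,
    by positivity, fun lab s hs hsR hbig => ?_⟩
  have h1 : 0 ≤ k.total * s := by positivity
  have h2 : 0 ≤ k.shock * s := by positivity
  have h3 : 0 ≤ k.deficit * s := by positivity
  have h4 : 0 ≤ k.growth * Real.cosh (R / 2) * s := by positivity
  have h5 : 0 ≤ 2 * k.count / ε * s := by positivity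
  cases lab
  · have hsε := hbig rfl
    have h6 : max 0 (ε - s) ≤ 2 * s := max_le (by linarith) (by linarith)
    have h7 := mul_le_mul_of_nonneg_left h6 hD
    have h7' := mul_nonneg hD (le_max_left 0 (ε - s))
    have h8 := W_sub_le le_rfl hs.le hsR
    rw [W_of_nonpos le_rfl, sub_zero, sub_zero] at h8
    have h9 := mul_le_mul_of_nonneg_left h8 hG
    have h9' := mul_nonneg hG (hs.le.trans (le_W_of_nonneg hs.le))
    have h10 : k.count ≤ 2 * k.count / ε * s := by
      rw [div_mul_eq_mul_div, le_div_iff₀ hε]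
      nlinarith
    simp only [Coeffs.potential]
    rw [abs_le]
    constructor <;> linarith
  all_goals
    simp only [Coeffs.potential]
    rw [abs_le]
    constructor <;> linarith

/-- The logarithm of the ratio of the weights at a front is at most proportional to its strength. -/
lemma Params.Valid.exp_le_ratio_le {c : Params} (hc : c.Valid) {f : Front} (hf : f.Admissible c) :
    Real.exp (-((2 * c.C₀ + 2 * -Real.log c.C₁ / c.ε) * f.strength)) ≤ f.ratio c ∧
      f.ratio c ≤ Real.exp ((2 * c.C₀ + 2 * -Real.log c.C₁ / c.ε) * f.strength) := by
  have hq : 0 ≤ -Real.log c.C₁ := by linarith [Real.log_nonpos hc.C₁_pos.le hc.C₁_lt_one.le]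
  have hε := hc.ε_pos
  have hs := hf.pos
  have h1 : 0 < c.C₀ * f.strength := mul_pos hc.C₀_pos hs
  have h2 : 0 ≤ 2 * -Real.log c.C₁ / c.ε * f.strength := by positivity
  have hbig : f.label = .big → -Real.log c.C₁ ≤ 2 * -Real.log c.C₁ / c.ε * f.strength := by
    intro h
    have := hf.big h
    rw [div_mul_eq_mul_div, le_div_iff₀ hε]
    nlinarith
  have hsmall : f.label = .small → c.C₀ * f.strength ≤ 1 / 2 := fun h =>
    hc.C₀_mul_le (hf.small h).le
  obtain ⟨i, lab, s⟩ := f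
  simp only at hs h1 h2 hbig hsmall ⊢
  rw [add_mul, mul_assoc 2]
  cases lab <;> cases i <;> simp only [Front.ratio, true_implies, one_div] at hbig hsmall ⊢
  · constructor
    · rw [← Real.le_log_iff_exp_le hc.C₁_pos]
      linarith
    · exact hc.C₁_lt_one.le.trans (Real.one_le_exp (by linarith))
  · have := inv_pos.mpr hc.C₁_pos
    constructor
    · rw [← Real.le_log_iff_exp_le this, Real.log_inv]
      linarith
    · rw [← Real.log_le_iff_le_exp this, Real.log_inv]
      linarith
  · constructor
    · refine le_trans (Real.exp_le_exp.mpr ?_) (exp_neg_two_mul_le h1.le (by simpa using hsmall))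
      linarith
    · refine le_trans ?_ (Real.one_le_exp (by linarith))
      linarith
  · constructor
    · refine (Real.exp_le_one_iff.mpr (by linarith)).trans (by linarith)
    · refine le_trans ?_ (Real.add_one_le_exp _)
      linarith
  all_goals exact ⟨Real.exp_le_one_iff.mpr (by linarith), Real.one_le_exp (by linarith)⟩

lemma abs_sum_map_le {α : Type*} {l : List α} {g s : α → ℝ} {A : ℝ}
    (h : ∀ f ∈ l, |g f| ≤ A * s f) : |(l.map g).sum| ≤ A * (l.map s).sum := by
  induction l with
  | nil => simp
  | cons f l ih =>
    simp only [List.map_cons, List.sum_cons, mul_add]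
    exact (abs_add_le _ _).trans
      (add_le_add (h f (by simp)) (ih fun g hg => h g (List.mem_cons_of_mem _ hg)))

lemma exp_le_prod_map_le {α : Type*} {l : List α} {g s : α → ℝ} {A : ℝ}
    (h : ∀ f ∈ l, Real.exp (-(A * s f)) ≤ g f ∧ g f ≤ Real.exp (A * s f)) :
    Real.exp (-(A * (l.map s).sum)) ≤ (l.map g).prod ∧
      (l.map g).prod ≤ Real.exp (A * (l.map s).sum) := by
  induction l with
  | nil => simp
  | cons f l ih =>
    have hf := h f (by simp)
    have ih := ih fun g hg => h g (List.mem_cons_of_mem _ hg)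
    simp only [List.map_cons, List.sum_cons, List.prod_cons, mul_add, neg_add, Real.exp_add]
    exact ⟨mul_le_mul hf.1 ih.1 (Real.exp_pos _).le ((Real.exp_pos _).le.trans hf.1),
      mul_le_mul hf.2 ih.2 ((Real.exp_pos _).le.trans ih.1) (Real.exp_pos _).le⟩

/-! ### The initial strength -/

lemma wv_jump_le {β : ℝ} (hβ : 0 < β) {u u' : State} (hu : β ≤ u 0) (hu' : β ≤ u' 0) :
    |(wv u').1 - (wv u).1| + |(wv u').2 - (wv u).2| ≤ (1 / β + 1) * ‖u' - u‖ := by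
  have hlog : ∀ x y : ℝ, β ≤ x → β ≤ y → Real.log x - Real.log y ≤ 1 / β * |x - y| := by
    intro x y hx hy
    have hx0 := hβ.trans_le hx
    have hy0 := hβ.trans_le hy
    rw [← Real.log_div hx0.ne' hy0.ne']
    refine (Real.log_le_sub_one_of_pos (div_pos hx0 hy0)).trans ?_
    rw [div_sub_one hy0.ne', one_div_mul_eq_div]
    exact (div_le_div_of_nonneg_right (le_abs_self _) hy0.le).trans
      (div_le_div_of_nonneg_left (abs_nonneg _) hβ hy)
  have h0 : |u' 0 - u 0| ≤ ‖u' - u‖ := by simpa using PiLp.norm_apply_le (u' - u) 0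
  have h1 : |u' 1 - u 1| ≤ ‖u' - u‖ := by simpa using PiLp.norm_apply_le (u' - u) 1
  have h2 : |(wv u').1 - (wv u).1| ≤ 1 / β * |u' 0 - u 0| := by
    have g1 := hlog _ _ hu hu'
    have g2 := hlog _ _ hu' hu
    rw [abs_sub_comm] at g1
    simp only [wv]
    rw [abs_le]
    constructor <;> linarith
  have h3 : 1 / β * |u' 0 - u 0| ≤ 1 / β * ‖u' - u‖ :=
    mul_le_mul_of_nonneg_left h0 (by positivity)
  have h4 : |(wv u').2 - (wv u).2| ≤ ‖u' - u‖ := h1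
  linarith

lemma sum_norm_le_of_variation_le {ψ : StepDatum} {V : ℝ≥0} (h : ψ.variation ≤ V) :
    ∑ j : Fin ψ.m, ‖ψ.u j.succ - ψ.u j.castSucc‖ ≤ V := by
  have := ENNReal.toReal_mono ENNReal.coe_ne_top h
  rw [StepDatum.variation, ENNReal.toReal_sum (fun _ _ => enorm_ne_top)] at this
  simpa using this

lemma admissible_of_mem_initialFan {c : Params} (hc : c.Valid) (s₁ s₂ : ℝ) :
    ∀ f ∈ initialFan c.ε c.δ s₁ s₂, f.Admissible c := by
  have hadm : ∀ (i : Family) (s : ℝ), 0 < s →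
      (⟨i, initialLabel c.ε s, s⟩ : Front).Admissible c := by
    intro i s hs
    have := hc.ε_pos
    refine ⟨hs, ?_, ?_, ?_⟩ <;> simp only [initialLabel] <;> split_ifs with h
    · exact fun _ => by linarith
    · exact nofun
    · exact nofun
    · exact fun _ => not_le.mp h
    · exact nofun
    · exact nofun
  intro f hf
  rcases List.mem_append.mp hf with hf | hf
  · exact admissible_of_mem_fan hc.δ_pos (hadm _ _) f hf
  · exact admissible_of_mem_fan hc.δ_pos (hadm _ _) f hf

namespace Pattern

variable {c : Params} {ψ : StepDatum} (P : Pattern c ψ)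

/-- The fronts present between the interactions number `k` and `k + 1`, without their paths. -/
def fronts (k : ℕ) : List Front := (P.waves k).map Wave.toFront

/-- The factor by which the interaction number `k` multiplies `C₁ ^ L * Q`. -/
noncomputable def step (k : ℕ) : ℝ :=
  c.C₁ ^ ((P.coll k).type c.ε).jumpL * (P.coll k).factor c

lemma fronts_zero :
    P.fronts 0 = (List.ofFn fun j => initialFan c.ε c.δ (P.σ₁ j) (P.σ₂ j)).flatten := by
  rw [fronts, P.waves_zero, List.map_flatten, List.map_ofFn]
  congr 2
  funext j
  exact P.start_fronts j

lemma admissible_fronts_zero (hc : c.Valid) : ∀ f ∈ P.fronts 0, f.Admissible c := by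
  intro f hf
  rw [fronts_zero, List.mem_flatten] at hf
  obtain ⟨l, hl, hf⟩ := hf
  obtain ⟨j, rfl⟩ := List.mem_ofFn.mp hl
  exact admissible_of_mem_initialFan hc _ _ f hf

lemma sum_strength_fronts_zero_le (hc : c.Valid) {β : ℝ} (hβ : 0 < β) (hu : ∀ j, β ≤ ψ.u j 0)
    {V : ℝ≥0} (hV : ψ.variation ≤ V) :
    ((P.fronts 0).map Front.strength).sum ≤ (1 / β + 1) * V := by
  have h : ((P.fronts 0).map Front.strength).sum = ∑ j, (|P.σ₁ j| + |P.σ₂ j|) := by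
    rw [fronts_zero, List.map_flatten, List.sum_flatten, List.map_ofFn, List.map_ofFn,
      List.sum_ofFn]
    refine Finset.sum_congr rfl fun j _ => ?_
    simp [initialFan, sum_strength_fan hc.δ_pos]
  rw [h]
  calc ∑ j, (|P.σ₁ j| + |P.σ₂ j|)
      ≤ ∑ j : Fin ψ.m, (1 / β + 1) * ‖ψ.u j.succ - ψ.u j.castSucc‖ := by
        refine Finset.sum_le_sum fun j _ => le_trans ?_ (wv_jump_le hβ (hu _) (hu _))
        have hr := P.start_riemann j
        simp only [SolvesRiemann, waveCurve] at hr
        have h₁ := congrArg Prod.fst hr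
        have h₂ := congrArg Prod.snd hr
        simp only at h₁ h₂
        rw [abs_sub_comm (wv (ψ.u j.succ)).2]
        exact riemann_abs_add_abs_le (by linarith) (by linarith)
    _ = (1 / β + 1) * ∑ j : Fin ψ.m, ‖ψ.u j.succ - ψ.u j.castSucc‖ := by rw [Finset.mul_sum]
    _ ≤ (1 / β + 1) * V :=
        mul_le_mul_of_nonneg_left (sum_norm_le_of_variation_le hV) (by positivity)

/-! ### The interactions of a pattern -/

lemma stepBound (hc : c.Valid) {R : ℝ} (κ : Coeffs c.C₀ c.C₁ c.ε R) {k : ℕ} (hk : k < P.n)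
    (hadm : ∀ f ∈ P.fronts k, f.Admissible c) (hR : ((P.fronts k).map Front.strength).sum ≤ R) :
    StepBound c κ [(P.coll k).p.toFront, (P.coll k).q.toFront]
      ((P.coll k).out.map Wave.toFront) (P.step k) := by
  have hmem : ∀ f ∈ P.fronts k, f.strength ≤ R := fun f hf =>
    (List.single_le_sum (by
      intro x hx
      obtain ⟨g, hg, rfl⟩ := List.mem_map.mp hx
      exact (hadm g hg).pos.le) _ (List.mem_map_of_mem hf)).trans hR
  have hp : (P.coll k).p.toFront ∈ P.fronts k := by
    simp [fronts, P.waves_before k hk]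
  have hq : (P.coll k).q.toFront ∈ P.fronts k := by
    simp [fronts, P.waves_before k hk]
  have ho := P.occurs k hk
  rw [ho.out_fronts]
  refine (P.coll k).stepBound κ hc (hadm _ hp) (hadm _ hq) (hmem _ hp) (hmem _ hq)
    (z := stateAfter (wv (ψ.u 0)) (P.coll k).left) ?_
  simpa [stateAfter, List.foldl_append] using ho.riemann

/-- Admissibility of the fronts and the bound on their total strength persist, and the accumulated
factor is bounded from below through the potential. -/
lemma invariants (hc : c.Valid) {R : ℝ} (κ : Coeffs c.C₀ c.C₁ c.ε R)
    (hR : ((P.fronts 0).map Front.strength).sum ≤ R) {k : ℕ} (hk : k ≤ P.n) :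
    (∀ f ∈ P.fronts k, f.Admissible c) ∧ ((P.fronts k).map Front.strength).sum ≤ R ∧
      Real.exp (((P.fronts k).map fun f => κ.potential f.label f.strength).sum -
        ((P.fronts 0).map fun f => κ.potential f.label f.strength).sum) ≤
          ∏ j ∈ Finset.range k, P.step j ∧
      ∏ j ∈ Finset.range k, P.step j ≤ 1 := by
  induction k with
  | zero => exact ⟨P.admissible_fronts_zero hc, hR, by simp, by simp⟩
  | succ k ih =>
    obtain ⟨hadm, hsum, hexp, hone⟩ := ih (by omega)
    have hs := P.stepBound hc κ hk hadm hsum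
    have hb : P.fronts k = (P.coll k).left.map Wave.toFront ++
        [(P.coll k).p.toFront, (P.coll k).q.toFront] ++ (P.coll k).right.map Wave.toFront := by
      simp [fronts, P.waves_before k hk]
    have ha : P.fronts (k + 1) = (P.coll k).left.map Wave.toFront ++
        (P.coll k).out.map Wave.toFront ++ (P.coll k).right.map Wave.toFront := by
      simp [fronts, P.waves_after k hk]
    refine ⟨?_, ?_, ?_, ?_⟩
    · intro f hf
      rw [ha] at hf
      rw [hb] at hadm
      rcases List.mem_append.mp hf with hf | hf
      · rcases List.mem_append.mp hf with hf | hf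
        · exact hadm f (List.mem_append_left _ (List.mem_append_left _ hf))
        · exact hs.admissible f hf
      · exact hadm f (List.mem_append_right _ hf)
    · have := hs.strength_le
      refine le_trans ?_ hsum
      rw [ha, hb]
      simp only [List.map_append, List.sum_append]
      linarith
    · rw [Finset.prod_range_succ]
      refine le_trans (le_of_eq ?_) (mul_le_mul hexp hs.exp_le (Real.exp_pos _).le
        ((Real.exp_pos _).le.trans hexp))
      rw [← Real.exp_add, ha, hb]
      congr 1
      simp only [List.map_append, List.sum_append]
      ring
    · rw [Finset.prod_range_succ]
      exact mul_le_one₀ hone ((Real.exp_pos _).le.trans hs.exp_le) hs.le_one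

/-! ### Times and paths -/

lemma time_lt_time {j k : ℕ} (hjk : j < k) (hk : k ≤ P.n + 1) : P.time j < P.time k := by
  induction k, hjk using Nat.le_induction with
  | base => exact P.time_lt j (by omega)
  | succ k _ ih => exact (ih (by omega)).trans (P.time_lt k (by omega))

lemma time_le_time {j k : ℕ} (hjk : j ≤ k) (hk : k ≤ P.n + 1) : P.time j ≤ P.time k := by
  rcases hjk.eq_or_lt with rfl | h
  exacts [le_rfl, (P.time_lt_time h hk).le]

lemma before_eq_range {k : ℕ} (hk : k ≤ P.n) {t : ℝ} (h : ∀ j < k, P.time (j + 1) < t)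
    (ht : t ≤ P.time (k + 1)) : P.before t = Finset.range k := by
  ext j
  simp only [before, Finset.mem_filter, Finset.mem_range]
  constructor
  · rintro ⟨hj, hjt⟩
    by_contra! hkj
    linarith [P.time_le_time (show k + 1 ≤ j + 1 by omega) (by omega)]
  · exact fun hj => ⟨by omega, h j hj⟩

lemma before_eq_range_of_mem {k : ℕ} (hk : k ≤ P.n) {t : ℝ}
    (ht : t ∈ Ioc (P.time k) (P.time (k + 1))) : P.before t = Finset.range k :=
  P.before_eq_range hk
    (fun j hj => (P.time_le_time (show j + 1 ≤ k by omega) (by omega)).trans_lt ht.1) ht.2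

lemma exists_index {t : ℝ} (ht : t < P.T) :
    ∃ k ≤ P.n, (∀ j < k, P.time (j + 1) < t) ∧ t ≤ P.time (k + 1) := by
  classical
  have hex : ∃ k, t ≤ P.time (k + 1) := ⟨P.n, by rw [P.time_last]; exact ht.le⟩
  exact ⟨Nat.find hex, Nat.find_min' hex (by rw [P.time_last]; exact ht.le),
    fun j hj => not_le.mp (Nat.find_min hex hj), Nat.find_spec hex⟩

lemma continuousOn_path {k : ℕ} (hk : k ≤ P.n) {f : Wave} (hf : f ∈ P.waves k) :
    ContinuousOn f.path (Icc (P.time k) (P.time (k + 1))) := by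
  obtain ⟨l, r, hlr⟩ := List.append_of_mem hf
  have h := P.travels k hk l f r hlr
  obtain ⟨⟨i, lab, s⟩, path⟩ := f
  cases lab <;> cases i <;> simp only [Wave.Travels] at h
  · exact h.1.continuousOn
  · exact h.1.continuousOn
  · exact h.1.continuousOn
  · exact h.1.continuousOn
  all_goals
    obtain ⟨v, -, hv⟩ := h
    exact ContinuousOn.congr (by fun_prop) hv

end Pattern

/-! ### The weight as a product over the fronts -/

/-- The product of the ratios of the fronts of `l` that lie to the left of `x` at time `t`. -/
noncomputable def ratioProd (c : Params) (l : List Wave) (t x : ℝ) : ℝ :=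
  (l.map fun f => if f.path t < x then f.toFront.ratio c else 1).prod

lemma ratioProd_append (c : Params) (l l' : List Wave) (t x : ℝ) :
    ratioProd c (l ++ l') t x = ratioProd c l t x * ratioProd c l' t x := by
  simp [ratioProd]

lemma ratioProd_congr {c : Params} {l : List Wave} {t t' x x' : ℝ}
    (h : ∀ f ∈ l, f.path t < x ↔ f.path t' < x') : ratioProd c l t x = ratioProd c l t' x' := by
  unfold ratioProd
  congr 1
  exact List.map_congr_left fun f hf => if_congr (h f hf) rfl rfl

lemma ratioProd_of_eq {c : Params} {l : List Wave} {t y : ℝ} (h : ∀ f ∈ l, f.path t = y) (x : ℝ) :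
    ratioProd c l t x = if y < x then ((l.map Wave.toFront).map (Front.ratio c)).prod else 1 := by
  induction l with
  | nil => simp [ratioProd]
  | cons f l ih =>
    have hl := ih fun g hg => h g (List.mem_cons_of_mem _ hg)
    have hf := h f (by simp)
    unfold ratioProd at hl ⊢
    rw [List.map_cons, List.prod_cons, hl, hf]
    split_ifs <;> simp

lemma ratioProd_pos {c : Params} (hc : c.Valid) {l : List Wave}
    (h : ∀ f ∈ l, f.toFront.Admissible c) (t x : ℝ) : 0 < ratioProd c l t x := by
  refine List.prod_pos fun a ha => ?_
  obtain ⟨f, hf, rfl⟩ := List.mem_map.mp ha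
  split_ifs
  exacts [(h f hf).ratio_pos hc, one_pos]

/-- Off the shock curves, the functions `ξ` multiply to `ratioProd`. -/
lemma prod_xi_eq_ratioProd {c : Params} {l : List Wave} {t x : ℝ}
    (h : ∀ f ∈ l.filter (fun f => f.label.isShock), x ≠ f.path t) :
    ((l.filter (fun f => f.label.isShock)).map (fun f => f.xi c t x)).prod =
      ratioProd c l t x := by
  induction l with
  | nil => simp [ratioProd]
  | cons f l ih =>
    have hcons : ratioProd c (f :: l) t x =
        (if f.path t < x then f.toFront.ratio c else 1) * ratioProd c l t x := by
      simp [ratioProd]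
    rw [hcons]
    by_cases hf : f.label.isShock = true
    · rw [List.filter_cons_of_pos (p := fun f : Wave => f.label.isShock) hf] at h ⊢
      rw [List.map_cons, List.prod_cons, ih fun g hg => h g (List.mem_cons_of_mem _ hg)]
      congr 1
      rcases lt_or_gt_of_ne (h f (by simp)) with hx | hx
      · simp [Wave.xi, hx, hx.not_gt]
      · simp [Wave.xi, hx, hx.not_gt]
    · rw [List.filter_cons_of_neg (p := fun f : Wave => f.label.isShock) hf] at h ⊢
      have : f.toFront.ratio c = 1 := by
        obtain ⟨⟨i, lab, s⟩, path⟩ := f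
        cases lab <;> simp_all [Label.isShock, Front.ratio]
      rw [ih h, this, ite_self, one_mul]

/-- A point off the paths at time `t` stays on the same side of each of them for a while. -/
lemma eventually_path_lt_iff {l : List Wave} {S : Set ℝ} {t x : ℝ}
    (hcont : ∀ f ∈ l, ContinuousWithinAt f.path S t) (hx : ∀ f ∈ l, x ≠ f.path t) :
    ∀ᶠ s in 𝓝[S] t, ∀ f ∈ l, x ≠ f.path s ∧ (f.path s < x ↔ f.path t < x) := by
  refine (Filter.eventually_all_finite l.finite_toSet).mpr fun f hf => ?_
  rcases lt_or_gt_of_ne (hx f hf) with h | h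
  · filter_upwards [(hcont f hf).eventually_const_lt h] with s hs
    exact ⟨hs.ne, iff_of_false hs.not_gt h.not_gt⟩
  · filter_upwards [(hcont f hf).eventually_lt_const h] with s hs
    exact ⟨hs.ne', iff_of_true hs h⟩

lemma ae_forall_ne_path (l : List Wave) (t : ℝ) :
    ∀ᵐ x ∂(volume : Measure ℝ), ∀ f ∈ l, x ≠ f.path t := by
  refine (Filter.eventually_all_finite l.finite_toSet).mpr fun f _ => ?_
  exact compl_mem_ae_iff.mpr (measure_singleton (f.path t))

namespace Pattern

variable {c : Params} {ψ : StepDatum} (P : Pattern c ψ)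

lemma weight_eq {k : ℕ} {t x : ℝ} (h : P.before t = Finset.range k)
    (hx : ∀ f ∈ (P.waves k).filter (fun f => f.label.isShock), x ≠ f.path t) :
    P.weight t x = (∏ j ∈ Finset.range k, P.step j) * ratioProd c (P.waves k) t x := by
  rw [weight, shocksAt, wavesAt, L, Q, h, Finset.card_range, prod_xi_eq_ratioProd hx,
    ← Finset.prod_pow_eq_pow_sum, ← Finset.prod_mul_distrib]
  rfl

lemma tendsto_weight_time {k : ℕ} {S : Set ℝ} {t x : ℝ}
    (hb : ∀ᶠ s in 𝓝[S] t, P.before s = Finset.range k)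
    (hcont : ∀ f ∈ P.waves k, ContinuousWithinAt f.path S t) (hx : ∀ f ∈ P.waves k, x ≠ f.path t) :
    Tendsto (fun s => P.weight s x) (𝓝[S] t)
      (𝓝 ((∏ j ∈ Finset.range k, P.step j) * ratioProd c (P.waves k) t x)) := by
  refine tendsto_const_nhds.congr' ?_
  filter_upwards [hb, eventually_path_lt_iff hcont hx] with s hs hs'
  rw [P.weight_eq hs fun f hf => (hs' f (List.mem_of_mem_filter hf)).1]
  congr 1
  exact (ratioProd_congr fun f hf => (hs' f hf).2).symm

/-- The two-sided bound; `A` bounds the potential in terms of the strength. -/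
lemma weight_bounds (hc : c.Valid) {R A : ℝ} (κ : Coeffs c.C₀ c.C₁ c.ε R)
    (hR : ((P.fronts 0).map Front.strength).sum ≤ R) (hA0 : 0 ≤ A)
    (hA : ∀ (lab : Label) (s : ℝ), 0 < s → s ≤ R → (lab = .big → c.ε / 2 ≤ s) →
      |κ.potential lab s| ≤ A * s) {t : ℝ} (ht : t < P.T) {x : ℝ}
    (hx : ∀ f ∈ P.shocksAt t, x ≠ f.path t) :
    Real.exp (-(2 * (A * R) + (2 * c.C₀ + 2 * -Real.log c.C₁ / c.ε) * R)) ≤ P.weight t x ∧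
      P.weight t x ≤ Real.exp ((2 * c.C₀ + 2 * -Real.log c.C₁ / c.ε) * R) := by
  obtain ⟨k, hk, hk₁, hk₂⟩ := P.exists_index ht
  have hb := P.before_eq_range hk hk₁ hk₂
  rw [shocksAt, wavesAt, hb, Finset.card_range] at hx
  rw [P.weight_eq hb hx]
  obtain ⟨hadm, hsum, hexp, hone⟩ := P.invariants hc κ hR hk
  have hq : 0 ≤ -Real.log c.C₁ := by linarith [Real.log_nonpos hc.C₁_pos.le hc.C₁_lt_one.le]
  have hB : 0 ≤ 2 * c.C₀ + 2 * -Real.log c.C₁ / c.ε := by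
    have := hc.C₀_pos
    have := hc.ε_pos
    positivity
  set B := 2 * c.C₀ + 2 * -Real.log c.C₁ / c.ε with hBdef
  have hpot : ∀ j ≤ P.n,
      |((P.fronts j).map fun f => κ.potential f.label f.strength).sum| ≤ A * R := by
    intro j hj
    obtain ⟨hadm, hsum, -⟩ := P.invariants hc κ hR hj
    refine (abs_sum_map_le fun f hf => hA f.label f.strength (hadm f hf).pos ?_
      (hadm f hf).big).trans (mul_le_mul_of_nonneg_left hsum hA0)
    exact (List.single_le_sum (by
      intro x hx
      obtain ⟨g, hg, rfl⟩ := List.mem_map.mp hx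
      exact (hadm g hg).pos.le) _ (List.mem_map_of_mem hf)).trans hsum
  have h0 := abs_le.mp (hpot 0 (Nat.zero_le _))
  have h1 := abs_le.mp (hpot k hk)
  have hsum' : ((P.waves k).map fun f => f.strength).sum ≤ R := by
    simpa [fronts, Function.comp_def] using hsum
  have hprod : Real.exp (-(B * ((P.waves k).map fun f => f.strength).sum)) ≤
      ratioProd c (P.waves k) t x ∧
      ratioProd c (P.waves k) t x ≤ Real.exp (B * ((P.waves k).map fun f => f.strength).sum) := by
    refine exp_le_prod_map_le fun f hf => ?_
    have hf' := hadm f.toFront (List.mem_map_of_mem hf)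
    split_ifs
    · exact hc.exp_le_ratio_le hf'
    · have := mul_nonneg hB hf'.pos.le
      exact ⟨Real.exp_le_one_iff.mpr (by linarith), Real.one_le_exp this⟩
  have hBR := mul_le_mul_of_nonneg_left hsum' hB
  have hpos := (Real.exp_pos _).trans_le hprod.1
  constructor
  · rw [neg_add, Real.exp_add]
    exact mul_le_mul ((Real.exp_le_exp.mpr (by linarith)).trans hexp)
      ((Real.exp_le_exp.mpr (by linarith)).trans hprod.1) (Real.exp_pos _).le
      ((Real.exp_pos _).le.trans hexp)
  · exact (mul_le_of_le_one_left hpos.le hone).trans (hprod.2.trans (Real.exp_le_exp.mpr hBR))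

lemma weight_interaction (hc : c.Valid) {R : ℝ} (κ : Coeffs c.C₀ c.C₁ c.ε R)
    (hR : ((P.fronts 0).map Front.strength).sum ≤ R) {k : ℕ} (hk : k < P.n) :
    ∀ᵐ x ∂(volume : Measure ℝ), ∃ aMinus aPlus : ℝ,
      Tendsto (fun s => P.weight s x) (𝓝[<] P.time (k + 1)) (𝓝 aMinus) ∧
      Tendsto (fun s => P.weight s x) (𝓝[>] P.time (k + 1)) (𝓝 aPlus) ∧ aPlus ≤ aMinus := by
  have hlt := P.time_lt k hk.le
  have hlt' := P.time_lt (k + 1) hk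
  filter_upwards [ae_forall_ne_path (P.waves k) (P.time (k + 1)),
    ae_forall_ne_path (P.waves (k + 1)) (P.time (k + 1))] with x hx hx'
  refine ⟨_, _, P.tendsto_weight_time (k := k) ?_ ?_ hx,
    P.tendsto_weight_time (k := k + 1) ?_ ?_ hx', ?_⟩
  · filter_upwards [Ioo_mem_nhdsLT hlt] with s hs
    exact P.before_eq_range_of_mem hk.le ⟨hs.1, hs.2.le⟩
  · intro f hf
    exact (P.continuousOn_path hk.le hf _ (right_mem_Icc.mpr hlt.le)).mono_of_mem_nhdsWithin
      (Icc_mem_nhdsLT hlt)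
  · filter_upwards [Ioo_mem_nhdsGT hlt'] with s hs
    exact P.before_eq_range_of_mem hk ⟨hs.1, hs.2.le⟩
  · intro f hf
    exact (P.continuousOn_path hk hf _ (left_mem_Icc.mpr hlt'.le)).mono_of_mem_nhdsWithin
      (Icc_mem_nhdsGT hlt')
  · obtain ⟨hadm, hsum, hexp, -⟩ := P.invariants hc κ hR hk.le
    have hs := P.stepBound hc κ hk hadm hsum
    have ho := P.occurs k hk
    have hadm' : ∀ f ∈ P.waves k, f.toFront.Admissible c := fun f hf =>
      hadm _ (List.mem_map_of_mem hf)
    rw [P.waves_before k hk] at hadm' ⊢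
    rw [P.waves_after k hk, Finset.prod_range_succ]
    simp only [ratioProd_append]
    have hleft := ratioProd_pos hc
      (fun f hf => hadm' f (List.mem_append_left _ (List.mem_append_left _ hf)))
      (P.time (k + 1)) x
    have hright := ratioProd_pos hc (fun f hf => hadm' f (List.mem_append_right _ hf))
      (P.time (k + 1)) x
    have hmid : P.step k * ratioProd c (P.coll k).out (P.time (k + 1)) x ≤
        ratioProd c [(P.coll k).p, (P.coll k).q] (P.time (k + 1)) x := by
      rw [ratioProd_of_eq (y := (P.coll k).p.path (P.time (k + 1))) ho.out_start,
        ratioProd_of_eq (y := (P.coll k).p.path (P.time (k + 1))) (by simp [ho.meet])]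
      split_ifs
      · exact hs.ratio_le
      · rw [mul_one]
        exact hs.le_one
    have := mul_le_mul_of_nonneg_left hmid
      (mul_nonneg (mul_nonneg ((Real.exp_pos _).le.trans hexp) hleft.le) hright.le)
    linarith

lemma weight_jump (hc : c.Valid) {R : ℝ} (κ : Coeffs c.C₀ c.C₁ c.ε R)
    (hR : ((P.fronts 0).map Front.strength).sum ≤ R) {t : ℝ} (ht : t ∈ Ioo 0 P.T)
    (htk : ∀ k < P.n, t ≠ P.time (k + 1)) {f : Wave} (hf : f ∈ P.wavesAt t) :
    ∃ aLeft aRight : ℝ, Tendsto (P.weight t) (𝓝[<] f.path t) (𝓝 aLeft) ∧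
      Tendsto (P.weight t) (𝓝[>] f.path t) (𝓝 aRight) ∧ 0 < aLeft ∧
      aRight / aLeft = f.toFront.ratio c := by
  obtain ⟨k, hk, hk₁, hk₂⟩ := P.exists_index ht.2
  have hb := P.before_eq_range hk hk₁ hk₂
  have htime : t ∈ Ioo (P.time k) (P.time (k + 1)) := by
    constructor
    · rcases k with _ | k
      · rw [P.time_zero]
        exact ht.1
      · exact hk₁ k (by omega)
    · refine hk₂.lt_of_ne ?_
      rcases hk.lt_or_eq with h | rfl
      · exact htk k h
      · rw [P.time_last]
        exact ht.2.ne
  rw [wavesAt, hb, Finset.card_range] at hf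
  obtain ⟨l, r, hlr⟩ := List.append_of_mem hf
  have hord := P.ordered k hk t htime
  rw [hlr, List.pairwise_append, List.pairwise_cons] at hord
  obtain ⟨-, ⟨hr, -⟩, hl⟩ := hord
  replace hl : ∀ g ∈ l, g.path t < f.path t := fun g hg => hl g hg f (by simp)
  obtain ⟨hadm, -, hexp, -⟩ := P.invariants hc κ hR hk
  have hpos : 0 < ∏ j ∈ Finset.range k, P.step j := (Real.exp_pos _).trans_le hexp
  have hadm' : ∀ g ∈ l, g.toFront.Admissible c := fun g hg =>
    hadm _ (List.mem_map_of_mem (by rw [hlr]; exact List.mem_append_left _ hg))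
  -- Near `f.path t`, the other paths of the list lie on a fixed side.
  have hl' : ∀ᶠ x in 𝓝 (f.path t), ∀ g ∈ l, g.path t < x :=
    (Filter.eventually_all_finite l.finite_toSet).mpr fun g hg => eventually_gt_nhds (hl g hg)
  have hr' : ∀ᶠ x in 𝓝 (f.path t), ∀ g ∈ r, x < g.path t :=
    (Filter.eventually_all_finite r.finite_toSet).mpr fun g hg => eventually_lt_nhds (hr g hg)
  set a := (∏ j ∈ Finset.range k, P.step j) * ratioProd c l t (f.path t) with ha
  have ha0 : 0 < a := mul_pos hpos (ratioProd_pos hc hadm' _ _)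
  have hval : ∀ x, (∀ g ∈ l, g.path t < x) → (∀ g ∈ r, x < g.path t) → x ≠ f.path t →
      P.weight t x = a * if f.path t < x then f.toFront.ratio c else 1 := by
    intro x hxl hxr hxf
    rw [P.weight_eq hb, hlr, show l ++ f :: r = l ++ ([f] ++ r) from rfl, ratioProd_append,
      ratioProd_append, ratioProd_congr (x' := f.path t) (t' := t) fun g hg =>
        iff_of_true (hxl g hg) (hl g hg)]
    · have h1 : ratioProd c r t x = 1 := by
        refine List.prod_eq_one fun y hy => ?_
        obtain ⟨g, hg, rfl⟩ := List.mem_map.mp hy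
        exact if_neg (hxr g hg).not_gt
      rw [h1, ha]
      simp [ratioProd, mul_assoc]
    · intro g hg
      have hg := List.mem_of_mem_filter hg
      rw [hlr] at hg
      rcases List.mem_append.mp hg with hg | hg
      · exact (hxl g hg).ne'
      · rcases List.mem_cons.mp hg with rfl | hg
        · exact hxf
        · exact (hxr g hg).ne
  refine ⟨a, a * f.toFront.ratio c, ?_, ?_, ha0, mul_div_cancel_left₀ _ ha0.ne'⟩
  · refine tendsto_const_nhds.congr' ?_
    filter_upwards [nhdsWithin_le_nhds hl', nhdsWithin_le_nhds hr', self_mem_nhdsWithin]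
      with x h1 h2 h3
    rw [hval x h1 h2 (ne_of_lt h3), if_neg (not_lt.mpr (le_of_lt (mem_Iio.mp h3))), mul_one]
  · refine tendsto_const_nhds.congr' ?_
    filter_upwards [nhdsWithin_le_nhds hl', nhdsWithin_le_nhds hr', self_mem_nhdsWithin]
      with x h1 h2 h3
    rw [hval x h1 h2 (ne_of_gt h3), if_pos (mem_Ioi.mp h3)]

end Pattern

end FrontTracking

theorem proposition6p1 (C₀ C₁ ε : ℝ) (hC₀ : 0 < C₀) (hC₁ : 0 < C₁) (hε : 0 < ε)
    (hC₀ε : C₀ * ε ≤ 1 / 2) (hC₁ε : C₁ ≤ (1 - C₀ * ε) ^ 2)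
    (A B : ℝ≥0) (β : ℝ) (hβ : 0 < β) :
    ∃ cLow cHigh : ℝ, 0 < cLow ∧ 0 < cHigh ∧
      ∀ (δ : ℝ) (lam : ℝ≥0) (ν : ℝ), 0 < δ → δ < ε / 2 → 0 < lam → 0 ≤ ν →
      ∀ u₀ : ℝ → FrontTracking.State, MemLp u₀ ⊤ volume → eLpNorm u₀ ⊤ volume ≤ A →
        FrontTracking.essVariation u₀ ≤ B → (∀ᵐ x ∂(volume : Measure ℝ), β ≤ u₀ x 0) →
      ∀ ψ : FrontTracking.StepDatum, ψ.Approximates u₀ β →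
      ∀ P : FrontTracking.Pattern ⟨C₀, C₁, ε, δ, lam, ν⟩ ψ,
        -- two-sided bounds off the shock curves
        (∀ t ∈ Ico 0 P.T, ∀ x : ℝ, (∀ f ∈ P.shocksAt t, x ≠ f.path t) →
          cLow ≤ P.weight t x ∧ P.weight t x ≤ cHigh) ∧
        -- the weight does not increase across an interaction
        (∀ k < P.n, ∀ᵐ x ∂(volume : Measure ℝ), ∃ aMinus aPlus : ℝ,
          Tendsto (fun s => P.weight s x) (𝓝[<] P.time (k + 1)) (𝓝 aMinus) ∧
          Tendsto (fun s => P.weight s x) (𝓝[>] P.time (k + 1)) (𝓝 aPlus) ∧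
          aPlus ≤ aMinus) ∧
        -- jumps of the weight across shocks, at times without interaction
        (∀ t ∈ Ioo 0 P.T, (∀ k < P.n, t ≠ P.time (k + 1)) →
          ∀ f ∈ P.wavesAt t, f.label.isShock = true → ∃ aLeft aRight : ℝ,
            Tendsto (P.weight t) (𝓝[<] f.path t) (𝓝 aLeft) ∧
            Tendsto (P.weight t) (𝓝[>] f.path t) (𝓝 aRight) ∧ 0 < aLeft ∧
            (f.label = .big → f.fam = .one → aRight / aLeft = C₁) ∧
            (f.label = .big → f.fam = .two → aRight / aLeft = 1 / C₁) ∧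
            (f.label = .small → f.fam = .one → aRight / aLeft = 1 - C₀ * f.strength) ∧
            (f.label = .small → f.fam = .two → aRight / aLeft = 1 + C₀ * f.strength)) := by
  -- `R` bounds the total strength of the fronts at all times.
  set V : ℝ≥0 := 2 * B
  set R : ℝ := (1 / β + 1) * V
  have hR : 0 ≤ R := by positivity
  have hC₁' : C₁ ≤ 1 := by
    refine hC₁ε.trans (pow_le_one₀ (by linarith) ?_)
    linarith [mul_pos hC₀ hε]
  obtain ⟨κ⟩ := FrontTracking.nonempty_coeffs hC₀ hC₁ hC₁' hε hR
  obtain ⟨A', hA0, hA⟩ := κ.exists_abs_potential_le hC₀ hC₁ hC₁' hε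
  refine ⟨_, _, Real.exp_pos (-(2 * (A' * R) + (2 * C₀ + 2 * -Real.log C₁ / ε) * R)),
    Real.exp_pos ((2 * C₀ + 2 * -Real.log C₁ / ε) * R), ?_⟩
  intro δ lam ν hδ hδε _ _ u₀ _ _ hvar _ ψ hψ P
  have hc : FrontTracking.Params.Valid ⟨C₀, C₁, ε, δ, lam, ν⟩ :=
    ⟨hC₀, hC₁, hε, hC₀ε, hC₁ε, hδ, hδε⟩
  have hV : ψ.variation ≤ V := by
    refine hψ.variation_le.trans ?_
    simp only [V, ENNReal.coe_mul, ENNReal.coe_ofNat]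
    gcongr
  have h₀ := P.sum_strength_fronts_zero_le hc hβ hψ.le_tau hV
  refine ⟨fun t ht x hx => P.weight_bounds hc κ h₀ hA0 hA ht.2 hx,
    fun k hk => P.weight_interaction hc κ h₀ hk, fun t ht htk f hf _ => ?_⟩
  obtain ⟨a, b, h₁, h₂, h₃, h₄⟩ := P.weight_jump hc κ h₀ ht htk hf
  refine ⟨a, b, h₁, h₂, h₃, ?_, ?_, ?_, ?_⟩ <;> intro hlab hfam <;>
    rw [h₄, FrontTracking.Front.ratio, hlab, hfam]
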